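/- **Setting.** Consider an infinite chessboard with squares indexed by $(i,j)\in\mathbb Z^2$. The square grid graph has as vertices the squares with $i+j$ odd, two of them being adjacent if they share exactly a corner; a vertex is white if $i$ is even and black if $i$ is odd, and $\mathrm d$ denotes the Euclidean distance scaled so that edges have length $1$. For integers $k,l\ge 0$, a hole of shape $O_{k,l}$ (an odd Aztec rectangle) with center $c$ is the set of squares having the color of the corner squares in the $(2k+1)\times(2l+1)$ chessboard centered at $c$, where $c$ is such that these squares are vertices of the grid graph (the corners may be white or black, so both placements of the hole are allowed). The charge $\mathrm q(O)$ of a finite set $O$ of vertices is its number of white vertices minus its number of black vertices. The toroidal Aztec rectangle $T_{m,n}$ is the graph of the vertices above with $i$ taken modulo $2m$ and $j$ modulo $2n$, and $\mathrm M(G)$ is the number of perfect matchings of $G$. **Correlation.** For holes $O_1,\dots,O_r$ of total charge $0$, $$\omega(O_1,\dots,O_r)=\lim_{n\to\infty}\frac{\mathrm M(T_{n,n}\setminus O_1\cup\dots\cup O_r)}{\mathrm M(T_{n,n})}.$$ The correlation of a single vertex is the number $\mu>0$ with $\mu^2=\lim \mathrm d(w,b)^{1/2}\,\omega(w,b)$,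 where $w$ is a fixed white vertex and $b$ is a black vertex tending to infinity. For total charge $\pm q$ with $q\ge 1$, the correlation is defined recursively by $$\omega(O_1,\dots,O_r)=\lim_{x\to\infty}\frac{\mathrm d(0,x)^{q/2}\,\omega(O_1,\dots,O_r,\{x\})}{\mu},$$ where $x$ tends to infinity through the vertices whose charge has sign opposite to the total charge of $O_1,\dots,O_r$. **Electrostatic conjecture (for odd Aztec rectangles).** Every hole in the shape of an odd Aztec rectangle has a correlation, every finite collection of such holes has one when their mutual distances are large enough, and for all $r$ and all shapes of the holes $O_1,\dots,O_r$ $$\omega(O_1,\dots,O_r)\sim\prod_{i=1}^r\omega(O_i)\prod_{1\le i<j\le r}\mathrm d(O_i,O_j)^{\frac12\mathrm q(O_i)\mathrm q(O_j)}$$ as all the mutual distances $\mathrm d(O_i,O_j)$ between the centers of the holes tend to infinity. **Theorem.** Assume that the electrostatic conjecture holds. Then for all integers $k,l\ge 0$, and for all placements of holes of shapes $O_{k,l}$ and $O_{0,k+l}$ in the grid graph, the correlations $\omega(O_{k,l})$ and $\omega(O_{0,k+l})$ exist and $$\omega(O_{k,l})=2^{-\frac{kl}{2}}\,\omega(O_{0,k+l}).$$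 -/

import Mathlib

open Filter Topology Asymptotics

namespace AztecWindows

/-! ### The square grid, its colouring, holes

The squares of an infinite chessboard are indexed by `ℤ × ℤ` (row, column). The vertices of the
(45 degrees rotated) square grid graph are the squares `(i, j)` with `i + j` odd, two of them being
adjacent when the squares share exactly a corner. The two bipartition classes are given by the
parity of the row index. -/

/-- The square `p` is a vertex of the grid graph. -/
abbrev IsVertex (p : ℤ × ℤ) : Prop := Odd (p.1 + p.2)

/-- White vertices of the grid graph. -/
abbrev IsWhite (p : ℤ × ℤ) : Prop := IsVertex p ∧ Even p.1

/-- Black vertices of the grid graph. -/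
abbrev IsBlack (p : ℤ × ℤ) : Prop := IsVertex p ∧ Odd p.1

/-- The charge of a finite set of vertices: number of white minus number of black vertices. -/
def charge (S : Finset (ℤ × ℤ)) : ℤ :=
  ((S.filter IsWhite).card : ℤ) - ((S.filter IsBlack).card : ℤ)

/-- Euclidean distance, in the scale in which the edges of the grid graph (which join diagonally
adjacent unit squares of the chessboard) have length one. -/
noncomputable def gridDist (p q : ℤ × ℤ) : ℝ :=
  √((((p.1 - q.1 : ℤ) : ℝ) ^ 2 + ((p.2 - q.2 : ℤ) : ℝ) ^ 2) / 2)

/-- The odd Aztec rectangle `O_{k,l}` centred at `c`: the squares of the corner colour of the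
chessboard with `2k+1` rows and `2l+1` columns centred at `c`. -/
noncomputable def oddAztecRect (k l : ℕ) (c : ℤ × ℤ) : Finset (ℤ × ℤ) :=
  (Finset.Icc (c.1 - k) (c.1 + k) ×ˢ Finset.Icc (c.2 - l) (c.2 + l)).filter
    (fun p => Even ((p.1 - (c.1 - k)) + (p.2 - (c.2 - l))))

/-- `c` is an admissible centre for a hole of shape `O_{k,l}` in the grid graph: the corners of the
chessboard of the hole are vertices of the grid graph. Both placements (corners white, that is
white-placed, and corners black, that is black-placed) are covered. -/
def IsCentre (k l : ℕ) (c : ℤ × ℤ) : Prop := IsVertex (c.1 - k, c.2 - l)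

/-! ### Toroidal Aztec rectangles and perfect matchings -/

/-- Reduction of a square of the infinite chessboard modulo `2m` rows and `2n` columns. -/
def toTorus (m n : ℕ) (p : ℤ × ℤ) : ZMod (2 * m) × ZMod (2 * n) :=
  ((p.1 : ZMod (2 * m)), (p.2 : ZMod (2 * n)))

/-- The relation "share a corner" on the squares of the `2m × 2n` toroidal chessboard. -/
def cornerGraph (m n : ℕ) : SimpleGraph (ZMod (2 * m) × ZMod (2 * n)) where
  Adj u v := u ≠ v ∧ (v.1 = u.1 + 1 ∨ u.1 = v.1 + 1) ∧ (v.2 = u.2 + 1 ∨ u.2 = v.2 + 1)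
  symm := ⟨fun _ _ h => ⟨h.1.symm, h.2.1.symm, h.2.2.symm⟩⟩
  loopless := ⟨fun _ h => h.1 rfl⟩

/-- The vertices of `T_{m,n}`. The white squares of a `(2m+1) × (2n+1)` chessboard with black
corners are the squares `(i, j)`, `0 ≤ i ≤ 2m`, `0 ≤ j ≤ 2n`, with `i + j` odd; identifying opposite
sides amounts to reducing `i` modulo `2m` and `j` modulo `2n`. -/
def torusVertices (m n : ℕ) : Set (ZMod (2 * m) × ZMod (2 * n)) :=
  toTorus m n '' {p | IsVertex p}

/-- The toroidal Aztec rectangle graph `T_{m,n}` with the vertices in `S` removed. -/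
def torusMinus (m n : ℕ) (S : Finset (ℤ × ℤ)) :
    SimpleGraph ↥(torusVertices m n \ toTorus m n '' (S : Set (ℤ × ℤ))) :=
  (cornerGraph m n).induce (torusVertices m n \ toTorus m n '' (S : Set (ℤ × ℤ)))

/-- The number of perfect matchings of a graph. -/
noncomputable def numMatchings {V : Type*} (G : SimpleGraph V) : ℕ :=
  Nat.card {M : G.Subgraph // M.IsPerfectMatching}

/-! ### Correlation -/

/-- The finite size correlation `ω_{m,n}` of a collection of holes with union `S`. -/
noncomputable def finiteCorrelation (m n : ℕ) (S : Finset (ℤ × ℤ)) : ℝ :=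
  (numMatchings (torusMinus m n S) : ℝ) / (numMatchings (torusMinus m n ∅) : ℝ)

/-- `a` is the correlation of the neutral collection of holes with union `S`. -/
def HasNeutralCorrelation (S : Finset (ℤ × ℤ)) (a : ℝ) : Prop :=
  Tendsto (fun n : ℕ => finiteCorrelation n n S) atTop (𝓝 a)

/-- `x → ∞` in the grid, through the vertices `x` with property `P`. -/
def farAway (P : ℤ × ℤ → Prop) : Filter (ℤ × ℤ) := cofinite ⊓ 𝓟 {x | P x}

/-- `μ` is the correlation of a single monomer: `μ > 0` and the correlation of a white monomer (at
the vertex `(0, 1)`) and a black monomer at distance `d` is asymptotically `μ² d^(-1/2)`. -/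
def IsMonomerCorrelation (μ : ℝ) : Prop :=
  0 < μ ∧ ∃ g : ℤ × ℤ → ℝ,
    (∀ᶠ x in farAway IsBlack, HasNeutralCorrelation {(0, 1), x} (g x)) ∧
    Tendsto (fun x => gridDist (0, 1) x ^ (1 / 2 : ℝ) * g x) (farAway IsBlack) (𝓝 (μ ^ 2))

/-- Extension of the correlation to a total charge `±q`, by recursion on `q`: a monomer `x` whose
charge is opposite to that of `S` is sent to infinity, and the correlation of `S ∪ {x}` is divided
by the correlation of the monomer and by its electrostatic interaction `d^(-q/2)` with `S`. -/
def HasCorrelationOfCharge : ℕ → Finset (ℤ × ℤ) → ℝ → Prop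
  | 0, S, a => HasNeutralCorrelation S a
  | q + 1, S, a =>
      ∃ μ : ℝ, IsMonomerCorrelation μ ∧ ∃ f : ℤ × ℤ → ℝ,
        (∀ᶠ x in farAway (if 0 < charge S then IsBlack else IsWhite),
          HasCorrelationOfCharge q (insert x S) (f x)) ∧
        Tendsto (fun x => gridDist 0 x ^ (((q + 1 : ℕ) : ℝ) / 2) * f x / μ)
          (farAway (if 0 < charge S then IsBlack else IsWhite)) (𝓝 a)

/-- `a` is the correlation `ω` of a collection of holes, of arbitrary total charge, with
union `S`. -/
def HasCorrelation (S : Finset (ℤ × ℤ)) (a : ℝ) : Prop :=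
  HasCorrelationOfCharge (charge S).natAbs S a

open Classical in
/-- The correlation `ω` of a collection of holes with union `S` (zero if the limits that define it
do not exist). -/
noncomputable def correlation (S : Finset (ℤ × ℤ)) : ℝ :=
  if h : ∃ a, HasCorrelation S a then h.choose else 0

/-! ### The electrostatic conjecture -/

/-- The union of the holes of shapes `O_{k i, l i}` with centres `c i`. -/
noncomputable def holes {r : ℕ} (k l : Fin r → ℕ) (c : Fin r → ℤ × ℤ) : Finset (ℤ × ℤ) :=
  Finset.univ.biUnion fun i => oddAztecRect (k i) (l i) (c i)

/-- The limit of large mutual separations, through admissible centres of holes of shapes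
`O_{k i, l i}`. -/
noncomputable def largeSeparation {r : ℕ} (k l : Fin r → ℕ) : Filter (Fin r → ℤ × ℤ) :=
  (⨅ (i : Fin r) (j : Fin r) (_ : i < j), comap (fun c => gridDist (c i) (c j)) atTop) ⊓
    𝓟 {c | ∀ i, IsCentre (k i) (l i) (c i)}

/-- The electrostatic conjecture for holes in the shape of odd Aztec rectangles (with the
multiplicative constant being the product of the individual correlations): each such hole has a
correlation, any finite collection of them has one when the mutual separations are large, and
`ω(O_1, …, O_r) ∼ ∏ ω(O_i) ∏_{i<j} d(O_i, O_j)^{q(O_i) q(O_j) / 2}`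
in the limit of large mutual separations. -/
def ElectrostaticConjecture : Prop :=
  (∀ (k l : ℕ) (c : ℤ × ℤ), IsCentre k l c → ∃ a, HasCorrelation (oddAztecRect k l c) a) ∧
  ∀ (r : ℕ) (k l : Fin r → ℕ),
    (∀ᶠ c in largeSeparation k l, ∃ a, HasCorrelation (holes k l c) a) ∧
    (fun c => correlation (holes k l c)) ~[largeSeparation k l]
      (fun c => (∏ i, correlation (oddAztecRect (k i) (l i) (c i))) *
        ∏ p : Fin r × Fin r with p.1 < p.2,
          gridDist (c p.1) (c p.2) ^
            ((1 / 2 : ℝ) * (charge (oddAztecRect (k p.1) (l p.1) (c p.1)) : ℝ) *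
              (charge (oddAztecRect (k p.2) (l p.2) (c p.2)) : ℝ)))

end AztecWindows

/-! The engine is a complementation identity for matchings. The squares with both coordinates even
("cells") are surrounded by 4-cycles of the grid graph; every edge lies in exactly one of these
cycles, and every vertex in exactly two of them, on opposite sides. A perfect matching therefore
records, for each cell, which of its four vertices are matched inside it. Complementing this record
in every cell outside a set `B` of forced-empty cells turns a configuration for a hole system `S`
into one for another system `S'`. A cell has 1, 1 or 2 matchings when 0, 2 or 4 of its vertices are
covered, and complementation changes this weight by a factor depending only on the number covered.
The total number covered is fixed, so summation gives `M(S) · √2^|S| = M(S') · 2^|B|`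
(`card_edgeConfigs_complement`).

A white-placed `O_{k,l+1}` and the black-placed `O_{k+1,l}` with the same centre are complementary
in this sense (`planarComplementary_oddAztecRect`). Their charges are `k+l+2` and `-(k+l+2)`. For
neutrality, a second, distant hole of transposed shape and opposite charge is exchanged at the same
time; the counts then differ by the factor `2^(k-l)` (`numMatchings_two_holes`).

The conjecture factors the correlation of each neutral pair into the two individual correlations and
a power of the distance. This power is the same before and after the exchange. The two holes of a
pair have equal correlations, because translations and the transposition preserve correlations even
when they swap colours (`IsGridSymmetry.correlation_image`). Hence `ω(O_{k,l+1})² 2^k =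
ω(O_{k+1,l})² 2^l`. Induction on `k` gives `ω(O_{k,l})² 2^(kl) = ω(O_{0,k+l})²`, and nonnegativity
permits taking square roots. -/

open Filter Topology Asymptotics

namespace AztecWindows

/-! ### Configurations of edges around the cells -/

/-- A set of edges of a cell (a 4-cycle): the edge joining the white vertex on side `σ` to the black
vertex on side `τ` is present when the value at `σ`, `τ` is `true`. -/
abbrev CellState := Bool → Bool → Bool

/-- A set of vertices of a cell: the white ones and the black ones. -/
abbrev CellFlags := (Bool → Bool) × (Bool → Bool)

/-- The edges of `s` are pairwise disjoint. -/
abbrev CellState.Disjoint (s : CellState) : Prop :=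
  (∀ σ, ¬(s σ true = true ∧ s σ false = true)) ∧ ∀ τ, ¬(s true τ = true ∧ s false τ = true)

/-- The vertices of a cell covered by a set of edges. -/
def CellState.flags (s : CellState) : CellFlags :=
  (fun σ => s σ true || s σ false, fun τ => s true τ || s false τ)

/-- The number of perfect matchings of the subgraph of a cell induced by a set of vertices. -/
def cellCount (f : CellFlags) : ℕ :=
  (Finset.univ.filter fun s : CellState => s.Disjoint ∧ s.flags = f).card

/-- The number of vertices in a set of vertices of a cell. -/
def numFlags (f : CellFlags) : ℕ :=
  (f.1 true).toNat + (f.1 false).toNat + ((f.2 true).toNat + (f.2 false).toNat)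

/-- The complementary set of vertices of a cell. -/
def complFlags (f : CellFlags) : CellFlags := (fun σ => !f.1 σ, fun τ => !f.2 τ)

-- The matchable vertex sets of a 4-cycle are the empty set, the four white-black pairs and the
-- whole cycle. This family is closed under complement, so complementation never creates an
-- unmatchable cell.
set_option maxRecDepth 100000 in
theorem cellCount_cases : ∀ f : CellFlags,
    (cellCount f = 0 ∧ cellCount (complFlags f) = 0) ∨
    (numFlags f = 0 ∧ cellCount f = 1 ∧ cellCount (complFlags f) = 2) ∨
    (numFlags f = 2 ∧ cellCount f = 1 ∧ cellCount (complFlags f) = 1) ∨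
    (numFlags f = 4 ∧ cellCount f = 2 ∧ cellCount (complFlags f) = 1) := by
  decide

-- A matchable set has as many white as black vertices; without white ones it is empty.
set_option maxRecDepth 100000 in
theorem flags_eq_false_of_white : ∀ f : CellFlags, cellCount f ≠ 0 → f.1 true = false →
    f.1 false = false → f = (fun _ => false, fun _ => false) := by
  decide

set_option maxRecDepth 100000 in
theorem flags_eq_false_of_black : ∀ f : CellFlags, cellCount f ≠ 0 → f.2 true = false →
    f.2 false = false → f = (fun _ => false, fun _ => false) := by
  decide

/-- The ratio of the two weights depends only on the number of covered vertices, so its product over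
all cells is the same for every matching. -/
theorem cellCount_mul_two (f : CellFlags) :
    (cellCount f : ℝ) * 2 = cellCount (complFlags f) * √2 ^ numFlags f := by
  have h4 : √(2 : ℝ) ^ 4 = 4 := by
    rw [show 4 = 2 * 2 from rfl, pow_mul, Real.sq_sqrt (by norm_num)]; norm_num
  rcases cellCount_cases f with ⟨h, h'⟩ | ⟨h, h', h''⟩ | ⟨h, h', h''⟩ | ⟨h, h', h''⟩ <;>
    simp only [*] <;> norm_num

/-! ### Complementation of matchings, cell by cell -/

variable {Γ : Type*}

/-- Sides of cells covered from `φ`, together with the removed vertices (counted by `Sw` and `Sb`),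
cover each vertex exactly once. The white vertex numbered `γ` lies on the `true` side of the cell
`γ` and on the `false` side of the cell `r γ`, and similarly for the black ones and `d`. -/
def FlagsCover (r d : Γ ≃ Γ) (Sw Sb : Γ → ℕ) (φ : Γ → CellFlags) : Prop :=
  (∀ γ, ((φ γ).1 true).toNat + ((φ (r γ)).1 false).toNat + Sw γ = 1) ∧
    ∀ γ, ((φ γ).2 true).toNat + ((φ (d γ)).2 false).toNat + Sb γ = 1

open Classical in
/-- The sets of vertices covered from the cells in a matching of the complement of the holes. -/
noncomputable def flagConfigs [Fintype Γ] (r d : Γ ≃ Γ) (Sw Sb : Γ → ℕ) :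
    Finset (Γ → CellFlags) :=
  Finset.univ.filter fun φ => FlagsCover r d Sw Sb φ ∧ ∀ γ, cellCount (φ γ) ≠ 0

open Classical in
/-- The matchings of the complement of the holes, as families of sets of edges of cells. -/
noncomputable def edgeConfigs [Fintype Γ] (r d : Γ ≃ Γ) (Sw Sb : Γ → ℕ) :
    Finset (Γ → CellState) :=
  Finset.univ.filter fun A => (∀ γ, (A γ).Disjoint) ∧ FlagsCover r d Sw Sb fun γ => (A γ).flags

/-- Once the covered sets are prescribed, the cells choose their edges independently. -/
theorem card_edgeConfigs [Fintype Γ] (r d : Γ ≃ Γ) (Sw Sb : Γ → ℕ) :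
    (edgeConfigs r d Sw Sb).card = ∑ φ ∈ flagConfigs r d Sw Sb, ∏ γ, cellCount (φ γ) := by
  classical
  rw [Finset.card_eq_sum_card_fiberwise (f := fun A γ => (A γ).flags)
    (t := flagConfigs r d Sw Sb)]
  · refine Finset.sum_congr rfl fun φ hφ => ?_
    simp only [cellCount, ← Fintype.card_piFinset]
    congr 1
    ext A
    simp only [flagConfigs, Finset.mem_filter, Finset.mem_univ, true_and] at hφ
    simp only [edgeConfigs, Finset.mem_filter, Finset.mem_univ, true_and, Fintype.mem_piFinset,
      funext_iff]
    constructor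
    · rintro ⟨⟨h1, -⟩, h2⟩ γ
      exact ⟨h1 γ, h2 γ⟩
    · intro h
      refine ⟨⟨fun γ => (h γ).1, ?_⟩, fun γ => (h γ).2⟩
      rw [show (fun γ => (A γ).flags) = φ from funext fun γ => (h γ).2]
      exact hφ.1
  · intro A hA
    simp only [edgeConfigs, Finset.coe_filter, Finset.mem_univ, true_and, Set.mem_ofPred_eq] at hA
    simp only [flagConfigs, Finset.coe_filter, Finset.mem_univ, true_and, Set.mem_ofPred_eq]
    refine ⟨hA.2, fun γ => ?_⟩
    rw [cellCount, ← Nat.pos_iff_ne_zero, Finset.card_pos]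
    exact ⟨A γ, by simpa using hA.1 γ⟩

/-- The combinatorial relation between two families of holes that are exchanged by
complementation, `B` being the indicator of the cells that are left empty. -/
structure Complementary (r d : Γ ≃ Γ) (Sw Sb Sw' Sb' B : Γ → ℕ) : Prop where
  white : ∀ γ, Sw γ + Sw' γ = B γ + B (r γ)
  black : ∀ γ, Sb γ + Sb' γ = B γ + B (d γ)
  cell : ∀ γ, B γ = 0 ∨ B γ = 1 ∧
    ((Sw γ = 1 ∧ Sw (r.symm γ) = 1 ∧ Sb' γ = 1 ∧ Sb' (d.symm γ) = 1) ∨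
      (Sb γ = 1 ∧ Sb (d.symm γ) = 1 ∧ Sw' γ = 1 ∧ Sw' (r.symm γ) = 1))

theorem Complementary.symm {r d : Γ ≃ Γ} {Sw Sb Sw' Sb' B : Γ → ℕ}
    (h : Complementary r d Sw Sb Sw' Sb' B) : Complementary r d Sw' Sb' Sw Sb B where
  white γ := by rw [add_comm, h.white]
  black γ := by rw [add_comm, h.black]
  cell γ := by have := h.cell γ; tauto

/-- Complementation of the sets of covered vertices outside of the cells in `B`. -/
def flipFlags (B : Γ → ℕ) (φ : Γ → CellFlags) (γ : Γ) : CellFlags :=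
  if B γ = 0 then complFlags (φ γ) else φ γ

theorem flipFlags_flipFlags (B : Γ → ℕ) (φ : Γ → CellFlags) :
    flipFlags B (flipFlags B φ) = φ := by
  funext γ
  by_cases h : B γ = 0 <;> simp [flipFlags, h, complFlags]

/-- A cell of `B` has both its white or both its black vertices removed, so none of its edges can be
used. -/
theorem FlagsCover.flags_eq_false {r d : Γ ≃ Γ} {Sw Sb Sw' Sb' B : Γ → ℕ}
    (h : Complementary r d Sw Sb Sw' Sb' B) {φ : Γ → CellFlags} (hφ : FlagsCover r d Sw Sb φ)
    (hc : ∀ γ, cellCount (φ γ) ≠ 0) {γ : Γ} (hγ : B γ ≠ 0) :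
    φ γ = (fun _ => false, fun _ => false) := by
  obtain h0 | ⟨-, ⟨h1, h2, -, -⟩ | ⟨h1, h2, -, -⟩⟩ := h.cell γ
  · exact absurd h0 hγ
  · have e1 := hφ.1 γ
    have e2 := hφ.1 (r.symm γ)
    rw [r.apply_symm_apply] at e2
    refine flags_eq_false_of_white _ (hc γ) ?_ ?_ <;>
      rw [← Bool.toNat_eq_zero] <;> omega
  · have e1 := hφ.2 γ
    have e2 := hφ.2 (d.symm γ)
    rw [d.apply_symm_apply] at e2
    refine flags_eq_false_of_black _ (hc γ) ?_ ?_ <;>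
      rw [← Bool.toNat_eq_zero] <;> omega

theorem flipFlags_toNat {B : Γ → ℕ} {φ : Γ → CellFlags} (hB : ∀ γ, B γ ≤ 1)
    (h : ∀ γ, B γ ≠ 0 → φ γ = (fun _ => false, fun _ => false)) (γ : Γ) (b : Bool) :
    ((flipFlags B φ γ).1 b).toNat + ((φ γ).1 b).toNat + B γ = 1 ∧
      ((flipFlags B φ γ).2 b).toNat + ((φ γ).2 b).toNat + B γ = 1 := by
  by_cases h0 : B γ = 0
  · simp only [flipFlags, h0, if_true, complFlags]
    cases (φ γ).1 b <;> cases (φ γ).2 b <;> simp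
  · have := hB γ
    have h1 : B γ = 1 := by omega
    simp [flipFlags, h γ h0, h1]

theorem flipFlags_mem [Fintype Γ] {r d : Γ ≃ Γ} {Sw Sb Sw' Sb' B : Γ → ℕ}
    (h : Complementary r d Sw Sb Sw' Sb' B) {φ : Γ → CellFlags}
    (hφ : φ ∈ flagConfigs r d Sw Sb) : flipFlags B φ ∈ flagConfigs r d Sw' Sb' := by
  simp only [flagConfigs, Finset.mem_filter, Finset.mem_univ, true_and] at hφ ⊢
  obtain ⟨hφ, hc⟩ := hφ
  have hB : ∀ γ, B γ ≤ 1 := fun γ => by obtain h | h := h.cell γ <;> omega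
  have hf := flipFlags_toNat hB fun γ => hφ.flags_eq_false h hc (γ := γ)
  refine ⟨⟨fun γ => ?_, fun γ => ?_⟩, fun γ => ?_⟩
  -- On each side, new flag + old flag + `B` equals 1. Adding the two sides of a vertex, the old
  -- flags sum to `1 - Sw γ`, so by `h.white` the new ones sum to `1 - Sw' γ`.
  · have := (hf γ true).1
    have := (hf (r γ) false).1
    have := h.white γ
    have := hφ.1 γ
    omega
  · have := (hf γ true).2
    have := (hf (d γ) false).2
    have := h.black γ
    have := hφ.2 γ
    omega
  · have := cellCount_cases (φ γ)
    have := hc γ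
    unfold flipFlags
    split_ifs <;> omega

/-- There are two vertices per cell, and each one is either removed or covered from exactly one of
its two cells. -/
theorem sum_numFlags [Fintype Γ] {r d : Γ ≃ Γ} {Sw Sb : Γ → ℕ} {φ : Γ → CellFlags}
    (hφ : FlagsCover r d Sw Sb φ) :
    ∑ γ, numFlags (φ γ) + ∑ γ, (Sw γ + Sb γ) = 2 * Fintype.card Γ := by
  have h1 := Equiv.sum_comp r fun γ => ((φ γ).1 false).toNat
  have h2 := Equiv.sum_comp d fun γ => ((φ γ).2 false).toNat
  simp only [numFlags, Finset.sum_add_distrib, ← h1, ← h2]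
  have e1 : ∑ γ, (((φ γ).1 true).toNat + ((φ (r γ)).1 false).toNat + Sw γ) = Fintype.card Γ := by
    simp [hφ.1]
  have e2 : ∑ γ, (((φ γ).2 true).toNat + ((φ (d γ)).2 false).toNat + Sb γ) = Fintype.card Γ := by
    simp [hφ.2]
  simp only [Finset.sum_add_distrib] at e1 e2
  omega

theorem prod_cellCount_flipFlags [Fintype Γ] {r d : Γ ≃ Γ} {Sw Sb Sw' Sb' B : Γ → ℕ}
    (h : Complementary r d Sw Sb Sw' Sb' B) {φ : Γ → CellFlags}
    (hφ : φ ∈ flagConfigs r d Sw Sb) :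
    ((∏ γ, cellCount (φ γ) : ℕ) : ℝ) * √2 ^ (∑ γ, (Sw γ + Sb γ)) =
      ((∏ γ, cellCount (flipFlags B φ γ) : ℕ) : ℝ) * 2 ^ (∑ γ, B γ) := by
  simp only [flagConfigs, Finset.mem_filter, Finset.mem_univ, true_and] at hφ
  obtain ⟨hφ, hc⟩ := hφ
  -- A cell of `B` is empty and unflipped, so its factor 2 is not absorbed by complementation; this
  -- produces `2 ^ B γ`.
  have hloc : ∀ γ, (cellCount (φ γ) : ℝ) * 2 =
      cellCount (flipFlags B φ γ) * 2 ^ B γ * √2 ^ numFlags (φ γ) := by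
    intro γ
    by_cases h0 : B γ = 0
    · simp [flipFlags, h0, cellCount_mul_two (φ γ)]
    · have h1 : B γ = 1 := by obtain h | h := h.cell γ <;> omega
      have h2 : numFlags (φ γ) = 0 := by rw [hφ.flags_eq_false h hc h0]; rfl
      simp [flipFlags, h1, h2]
  have hprod := Finset.prod_congr (rfl : (Finset.univ : Finset Γ) = Finset.univ)
    fun γ _ => hloc γ
  simp only [Finset.prod_mul_distrib, Finset.prod_pow_eq_pow_sum, Finset.prod_const,
    Finset.card_univ] at hprod
  have hs : √(2 : ℝ) ^ (∑ γ, numFlags (φ γ)) * √2 ^ (∑ γ, (Sw γ + Sb γ)) =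
      2 ^ Fintype.card Γ := by
    rw [← pow_add, sum_numFlags hφ, pow_mul, Real.sq_sqrt (by norm_num)]
  have h2 : (2 : ℝ) ^ Fintype.card Γ ≠ 0 := by positivity
  push_cast
  apply mul_right_cancel₀ h2
  calc _ = (∏ γ, (cellCount (φ γ) : ℝ)) * 2 ^ Fintype.card Γ * √2 ^ (∑ γ, (Sw γ + Sb γ)) := by
        ring
    _ = _ := by rw [hprod, ← hs]; ring

/-- The complementation theorem. -/
theorem card_edgeConfigs_complement [Fintype Γ] {r d : Γ ≃ Γ} {Sw Sb Sw' Sb' B : Γ → ℕ}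
    (h : Complementary r d Sw Sb Sw' Sb' B) :
    ((edgeConfigs r d Sw Sb).card : ℝ) * √2 ^ (∑ γ, (Sw γ + Sb γ)) =
      ((edgeConfigs r d Sw' Sb').card : ℝ) * 2 ^ (∑ γ, B γ) := by
  rw [card_edgeConfigs, card_edgeConfigs, Nat.cast_sum, Nat.cast_sum, Finset.sum_mul,
    Finset.sum_mul]
  refine Finset.sum_nbij' (flipFlags B) (flipFlags B) (fun φ hφ => flipFlags_mem h hφ)
    (fun φ hφ => flipFlags_mem h.symm hφ) (fun φ _ => flipFlags_flipFlags B φ)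
    (fun φ _ => flipFlags_flipFlags B φ) fun φ hφ => prod_cellCount_flipFlags h hφ

/-! ### Perfect matchings as sets of edges -/

/-- Labelling edges by `E`, with distinguished white and black ends, replaces subgraphs by Boolean
functions. `hinj` excludes parallel edges and `hdisj` prevents an edge from being read in both
directions. -/
theorem card_isPerfectMatching_induce {V E : Type*} (G : SimpleGraph V) (W : Set V) (ew eb : E → V)
    (hinj : ∀ e e', ew e = ew e' → eb e = eb e' → e = e') (hdisj : ∀ e e', ew e ≠ eb e')
    (hadj : ∀ u ∈ W, ∀ v ∈ W, G.Adj u v ↔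
      ∃ e, (ew e = u ∧ eb e = v) ∨ (ew e = v ∧ eb e = u)) :
    Nat.card {M : (G.induce W).Subgraph // M.IsPerfectMatching} =
      Nat.card {A : E → Bool // ∀ v, (v ∈ W → ∃! e, A e = true ∧ (ew e = v ∨ eb e = v)) ∧
        (v ∉ W → ∀ e, A e = true → ¬(ew e = v ∨ eb e = v))} := by
  classical
  refine Nat.card_congr
    { toFun := fun M => ⟨fun e => decide (∃ (hu : ew e ∈ W) (hv : eb e ∈ W),
        M.1.Adj ⟨ew e, hu⟩ ⟨eb e, hv⟩), fun v => ⟨fun hv => ?_, fun hv e he => ?_⟩⟩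
      invFun := fun A => ⟨{ verts := Set.univ
                            Adj := fun u v => ∃ e, A.1 e = true ∧
                              ((ew e = u.1 ∧ eb e = v.1) ∨ (ew e = v.1 ∧ eb e = u.1))
                            adj_sub := ?_
                            edge_vert := fun _ => Set.mem_univ _
                            symm := ⟨?_⟩ }, ?_⟩
      left_inv := ?_
      right_inv := ?_ }
  · obtain ⟨w, hw, huniq⟩ := SimpleGraph.Subgraph.isPerfectMatching_iff.1 M.2 ⟨v, hv⟩
    obtain ⟨e, he⟩ := (hadj v hv w.1 w.2).1 (M.1.adj_sub hw)
    refine ⟨e, ⟨?_, ?_⟩, ?_⟩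
    · simp only [decide_eq_true_eq]
      rcases he with ⟨h1, h2⟩ | ⟨h1, h2⟩
      · subst h1; exact ⟨hv, h2 ▸ w.2, by convert hw⟩
      · subst h2; exact ⟨h1 ▸ w.2, hv, by convert hw.symm⟩
    · tauto
    · rintro e' ⟨he', hv'⟩
      simp only [decide_eq_true_eq] at he'
      obtain ⟨hu1, hv1, hA⟩ := he'
      rcases hv' with rfl | rfl
      · have h3 := congrArg Subtype.val (huniq _ hA)
        rcases he with ⟨h1, h2⟩ | ⟨h1, h2⟩
        · exact hinj _ _ h1.symm (h3.trans h2.symm)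
        · exact absurd h2.symm (hdisj _ _)
      · have h3 := congrArg Subtype.val (huniq _ hA.symm)
        rcases he with ⟨h1, h2⟩ | ⟨h1, h2⟩
        · exact absurd h1 (hdisj _ _)
        · exact hinj _ _ (h3.trans h1.symm) h2.symm
  · simp only [decide_eq_true_eq] at he
    obtain ⟨hu1, hv1, -⟩ := he
    rintro (rfl | rfl) <;> contradiction
  · rintro u v ⟨e, -, he⟩
    exact (hadj u u.2 v v.2).2 ⟨e, he⟩
  · rintro u v ⟨e, he, he'⟩
    exact ⟨e, he, he'.symm⟩
  · rw [SimpleGraph.Subgraph.isPerfectMatching_iff]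
    rintro ⟨v, hv⟩
    have hmem : ∀ e, A.1 e = true → ew e ∈ W ∧ eb e ∈ W := fun e he =>
      ⟨by_contra fun h => (A.2 _).2 h e he (Or.inl rfl),
        by_contra fun h => (A.2 _).2 h e he (Or.inr rfl)⟩
    obtain ⟨e, ⟨he, hev⟩, huniq⟩ := (A.2 v).1 hv
    rcases hev with rfl | rfl
    · refine ⟨⟨eb e, (hmem e he).2⟩, ⟨e, he, Or.inl ⟨rfl, rfl⟩⟩, ?_⟩
      rintro ⟨w, hw⟩ ⟨e', he', ⟨h1, h2⟩ | ⟨h1, h2⟩⟩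
      · obtain rfl := huniq e' ⟨he', Or.inl h1⟩
        exact Subtype.ext h2.symm
      · exact absurd h2.symm (hdisj _ _)
    · refine ⟨⟨ew e, (hmem e he).1⟩, ⟨e, he, Or.inr ⟨rfl, rfl⟩⟩, ?_⟩
      rintro ⟨w, hw⟩ ⟨e', he', ⟨h1, h2⟩ | ⟨h1, h2⟩⟩
      · exact absurd h1 (hdisj _ _)
      · obtain rfl := huniq e' ⟨he', Or.inr h2⟩
        exact Subtype.ext h1.symm
  · rintro ⟨M, hM⟩
    refine Subtype.ext (SimpleGraph.Subgraph.ext ?_ ?_)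
    · exact (SimpleGraph.Subgraph.isSpanning_iff.1 hM.2).symm
    · funext u v
      simp only [decide_eq_true_eq, eq_iff_iff]
      constructor
      · rintro ⟨e, ⟨hu, hv, h⟩, ⟨h1, h2⟩ | ⟨h1, h2⟩⟩
        · convert h <;> simp [*]
        · convert h.symm <;> simp [*]
      · intro h
        obtain ⟨e, he⟩ := (hadj u u.2 v v.2).1 (M.adj_sub h)
        refine ⟨e, ?_, he⟩
        rcases he with ⟨h1, h2⟩ | ⟨h1, h2⟩
        · exact ⟨h1 ▸ u.2, h2 ▸ v.2, by convert h⟩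
        · exact ⟨h1 ▸ v.2, h2 ▸ u.2, by convert h.symm⟩
  · rintro ⟨A, hA⟩
    refine Subtype.ext (funext fun e => ?_)
    rw [Bool.eq_iff_iff]
    simp only [decide_eq_true_eq]
    constructor
    · rintro ⟨hu, hv, e', he', ⟨h1, h2⟩ | ⟨h1, h2⟩⟩
      · rwa [hinj e e' h1.symm h2.symm]
      · exact absurd h1 (hdisj _ _)
    · intro he
      exact ⟨by_contra fun h => (hA _).2 h e he (Or.inl rfl),
        by_contra fun h => (hA _).2 h e he (Or.inr rfl), e, he, Or.inl ⟨rfl, rfl⟩⟩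

/-! ### The vertices of the torus, numbered by cells -/

/-- The map "multiplication by two" from `ℤ / n` to `ℤ / 2n`. -/
def dbl (n : ℕ) : ZMod n →+ ZMod (2 * n) :=
  ZMod.lift n ⟨zmultiplesHom (ZMod (2 * n)) 2, by
    have : ((2 * n : ℕ) : ZMod (2 * n)) = 0 := ZMod.natCast_self _
    push_cast at this
    simpa [mul_comm] using this⟩

theorem dbl_intCast (n : ℕ) (x : ℤ) : dbl n x = ((2 * x : ℤ) : ZMod (2 * n)) := by
  simp [dbl, mul_comm]

theorem dbl_one (n : ℕ) : dbl n 1 = 2 := by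
  simpa using dbl_intCast n 1

theorem dbl_injective (n : ℕ) : Function.Injective (dbl n) := by
  intro x y h
  obtain ⟨x, rfl⟩ := ZMod.intCast_surjective x
  obtain ⟨y, rfl⟩ := ZMod.intCast_surjective y
  rw [dbl_intCast, dbl_intCast, ZMod.intCast_eq_intCast_iff_dvd_sub] at h
  rw [ZMod.intCast_eq_intCast_iff_dvd_sub]
  push_cast at h
  rw [← mul_sub] at h
  exact Int.dvd_of_mul_dvd_mul_left two_ne_zero h

theorem dbl_ne_dbl_add_one (n : ℕ) (x y : ZMod n) : dbl n x ≠ dbl n y + 1 := by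
  intro h
  obtain ⟨x, rfl⟩ := ZMod.intCast_surjective x
  obtain ⟨y, rfl⟩ := ZMod.intCast_surjective y
  have h' : ((2 * x : ℤ) : ZMod (2 * n)) = ((2 * y + 1 : ℤ) : ZMod (2 * n)) := by
    rw [← dbl_intCast, h, dbl_intCast]; push_cast; rfl
  rw [ZMod.intCast_eq_intCast_iff_dvd_sub] at h'
  have h2 : (2 : ℤ) ∣ 2 * y + 1 - 2 * x := dvd_trans (by simp) h'
  omega

/-- The white vertex to the right of the cell `γ`. -/
def whitePt (n : ℕ) (γ : ZMod n × ZMod n) : ZMod (2 * n) × ZMod (2 * n) :=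
  (dbl n γ.1, dbl n γ.2 + 1)

/-- The black vertex below the cell `γ`. -/
def blackPt (n : ℕ) (γ : ZMod n × ZMod n) : ZMod (2 * n) × ZMod (2 * n) :=
  (dbl n γ.1 + 1, dbl n γ.2)

theorem whitePt_injective (n : ℕ) : Function.Injective (whitePt n) := by
  rintro ⟨a, b⟩ ⟨a', b'⟩ h
  simp only [whitePt, Prod.mk.injEq, add_left_inj] at h
  rw [dbl_injective n h.1, dbl_injective n h.2]

theorem blackPt_injective (n : ℕ) : Function.Injective (blackPt n) := by
  rintro ⟨a, b⟩ ⟨a', b'⟩ h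
  simp only [blackPt, Prod.mk.injEq, add_left_inj] at h
  rw [dbl_injective n h.1, dbl_injective n h.2]

theorem whitePt_ne_blackPt (n : ℕ) (γ γ' : ZMod n × ZMod n) : whitePt n γ ≠ blackPt n γ' :=
  fun h => dbl_ne_dbl_add_one n _ _ (congrArg Prod.fst h)

theorem toTorus_white (n : ℕ) (x y : ℤ) :
    toTorus n n (2 * x, 2 * y + 1) = whitePt n ((x : ZMod n), (y : ZMod n)) := by
  simp only [toTorus, whitePt, dbl_intCast]; push_cast; rfl

theorem toTorus_black (n : ℕ) (x y : ℤ) :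
    toTorus n n (2 * x + 1, 2 * y) = blackPt n ((x : ZMod n), (y : ZMod n)) := by
  simp only [toTorus, blackPt, dbl_intCast]; push_cast; rfl

theorem mem_torusVertices_iff (n : ℕ) (v : ZMod (2 * n) × ZMod (2 * n)) :
    v ∈ torusVertices n n ↔ (∃ γ, whitePt n γ = v) ∨ ∃ γ, blackPt n γ = v := by
  constructor
  · rintro ⟨⟨a, b⟩, h, rfl⟩
    have h : Odd (a + b) := h
    rcases Int.even_or_odd' a with ⟨x, rfl | rfl⟩
    · obtain ⟨y, rfl⟩ : ∃ y, b = 2 * y + 1 := by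
        obtain ⟨z, hz⟩ := h
        exact ⟨z - x, by omega⟩
      exact Or.inl ⟨_, (toTorus_white n x y).symm⟩
    · obtain ⟨y, rfl⟩ : ∃ y, b = 2 * y := by
        obtain ⟨z, hz⟩ := h
        exact ⟨z - x, by omega⟩
      exact Or.inr ⟨_, (toTorus_black n x y).symm⟩
  · rintro (⟨⟨x, y⟩, rfl⟩ | ⟨⟨x, y⟩, rfl⟩) <;>
      obtain ⟨x, rfl⟩ := ZMod.intCast_surjective x <;>
      obtain ⟨y, rfl⟩ := ZMod.intCast_surjective y
    · exact ⟨_, (⟨x + y, by ring⟩ : Odd (2 * x + (2 * y + 1))), toTorus_white n x y⟩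
    · exact ⟨_, (⟨x + y, by ring⟩ : Odd (2 * x + 1 + 2 * y)), toTorus_black n x y⟩

/-- The cell to the right. -/
def cellRight (n : ℕ) : ZMod n × ZMod n ≃ ZMod n × ZMod n :=
  (Equiv.refl _).prodCongr (Equiv.addRight 1)

/-- The cell below. -/
def cellDown (n : ℕ) : ZMod n × ZMod n ≃ ZMod n × ZMod n :=
  (Equiv.addRight 1).prodCongr (Equiv.refl _)

/-- The white endpoint of an edge. -/
def edgeWhite (n : ℕ) (e : (ZMod n × ZMod n) × Bool × Bool) : ZMod (2 * n) × ZMod (2 * n) :=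
  whitePt n (if e.2.1 then e.1 else (cellRight n).symm e.1)

/-- The black endpoint of an edge. -/
def edgeBlack (n : ℕ) (e : (ZMod n × ZMod n) × Bool × Bool) : ZMod (2 * n) × ZMod (2 * n) :=
  blackPt n (if e.2.2 then e.1 else (cellDown n).symm e.1)

theorem cornerGraph_adj_edge (n : ℕ) (e : (ZMod n × ZMod n) × Bool × Bool) :
    (cornerGraph n n).Adj (edgeWhite n e) (edgeBlack n e) := by
  refine ⟨whitePt_ne_blackPt n _ _, ?_, ?_⟩ <;>
    obtain ⟨⟨x, y⟩, σ, τ⟩ := e <;> cases σ <;> cases τ <;>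
    simp [edgeWhite, edgeBlack, whitePt, blackPt, cellRight, cellDown, dbl_one] <;> ring_nf <;> simp

theorem cornerGraph_adj_iff (n : ℕ) (u v : ZMod (2 * n) × ZMod (2 * n))
    (hu : u ∈ torusVertices n n) : (cornerGraph n n).Adj u v ↔
      ∃ e, (edgeWhite n e = u ∧ edgeBlack n e = v) ∨ (edgeWhite n e = v ∧ edgeBlack n e = u) := by
  constructor
  · rintro ⟨-, h1, h2⟩
    rw [mem_torusVertices_iff] at hu
    obtain ⟨v1, v2⟩ := v
    rcases hu with ⟨⟨x, y⟩, rfl⟩ | ⟨⟨x, y⟩, rfl⟩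
    · simp only [whitePt] at h1 h2
      rcases h1 with rfl | h1 <;> rcases h2 with rfl | h2
      · exact ⟨((x, y + 1), false, true), Or.inl (by
          simp [edgeWhite, edgeBlack, whitePt, blackPt, cellRight, dbl_one]; ring)⟩
      · obtain rfl := add_right_cancel h2
        exact ⟨((x, y), true, true), Or.inl (by simp [edgeWhite, edgeBlack, whitePt, blackPt])⟩
      · obtain rfl := sub_eq_of_eq_add h1
        exact ⟨((x, y + 1), false, false), Or.inl (by
          simp [edgeWhite, edgeBlack, whitePt, blackPt, cellRight, cellDown, dbl_one]
          constructor <;> ring)⟩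
      · obtain rfl := sub_eq_of_eq_add h1
        obtain rfl := add_right_cancel h2
        exact ⟨((x, y), true, false), Or.inl (by
          simp [edgeWhite, edgeBlack, whitePt, blackPt, cellDown, dbl_one]; ring)⟩
    · simp only [blackPt] at h1 h2
      rcases h1 with rfl | h1 <;> rcases h2 with rfl | h2
      · exact ⟨((x + 1, y), true, false), Or.inr (by
          simp [edgeWhite, edgeBlack, whitePt, blackPt, cellDown, dbl_one]; ring)⟩
      · obtain rfl := sub_eq_of_eq_add h2
        exact ⟨((x + 1, y), false, false), Or.inr (by
          simp [edgeWhite, edgeBlack, whitePt, blackPt, cellRight, cellDown, dbl_one]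
          constructor <;> ring)⟩
      · obtain rfl := add_right_cancel h1
        exact ⟨((x, y), true, true), Or.inr (by simp [edgeWhite, edgeBlack, whitePt, blackPt])⟩
      · obtain rfl := sub_eq_of_eq_add h2
        obtain rfl := add_right_cancel h1
        exact ⟨((x, y), false, true), Or.inr (by
          simp [edgeWhite, edgeBlack, whitePt, blackPt, cellRight, dbl_one]; ring)⟩
  · rintro ⟨e, ⟨rfl, rfl⟩ | ⟨rfl, rfl⟩⟩
    · exact cornerGraph_adj_edge n e
    · exact (cornerGraph_adj_edge n e).symm

/-- For `n = 1` the opposite sides of a cell coincide and edges become parallel. -/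
theorem edge_injective {n : ℕ} (hn : 2 ≤ n) (e e' : (ZMod n × ZMod n) × Bool × Bool)
    (hw : edgeWhite n e = edgeWhite n e') (hb : edgeBlack n e = edgeBlack n e') : e = e' := by
  have : Fact (1 < n) := ⟨hn⟩
  have hw := whitePt_injective n hw
  have hb := blackPt_injective n hb
  obtain ⟨⟨x, y⟩, σ, τ⟩ := e
  obtain ⟨⟨x', y'⟩, σ', τ'⟩ := e'
  cases σ <;> cases τ <;> cases σ' <;> cases τ' <;>
    simp [cellRight, cellDown, Prod.ext_iff] at hw hb ⊢ <;> simp_all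

/-- The four edges at a vertex are indexed by one of its two cells and one of two opposite ends.
Using exactly one of them means at most one in each cell and coverage from exactly one cell. -/
theorem existsUnique_bool_iff : ∀ P : Bool → Bool → Bool,
    (∃! b : Bool × Bool, P b.1 b.2 = true) ↔
      ¬(P true true = true ∧ P true false = true) ∧
      ¬(P false true = true ∧ P false false = true) ∧
      (P true true || P true false).toNat + (P false true || P false false).toNat = 1 := by
  unfold ExistsUnique
  decide

theorem forall_bool_not_iff : ∀ P : Bool → Bool → Bool,
    (∀ b : Bool × Bool, ¬P b.1 b.2 = true) ↔
      ¬(P true true = true ∧ P true false = true) ∧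
      ¬(P false true = true ∧ P false false = true) ∧
      (P true true || P true false).toNat + (P false true || P false false).toNat = 0 := by
  decide

theorem edgeWhite_eq_iff (n : ℕ) (γ : ZMod n × ZMod n) (e : (ZMod n × ZMod n) × Bool × Bool) :
    edgeWhite n e = whitePt n γ ↔
      ∃ b : Bool × Bool, ((if b.1 then γ else cellRight n γ), b.1, b.2) = e := by
  obtain ⟨γ', σ, τ⟩ := e
  rw [edgeWhite, (whitePt_injective n).eq_iff]
  constructor
  · rintro rfl
    exact ⟨(σ, τ), by cases σ <;> simp⟩
  · rintro ⟨⟨a, b⟩, h⟩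
    simp only [Prod.mk.injEq] at h
    obtain ⟨rfl, rfl, rfl⟩ := h
    cases a <;> simp

theorem edgeBlack_eq_iff (n : ℕ) (γ : ZMod n × ZMod n) (e : (ZMod n × ZMod n) × Bool × Bool) :
    edgeBlack n e = blackPt n γ ↔
      ∃ b : Bool × Bool, ((if b.1 then γ else cellDown n γ), b.2, b.1) = e := by
  obtain ⟨γ', σ, τ⟩ := e
  rw [edgeBlack, (blackPt_injective n).eq_iff]
  constructor
  · rintro rfl
    exact ⟨(τ, σ), by cases τ <;> simp⟩
  · rintro ⟨⟨a, b⟩, h⟩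
    simp only [Prod.mk.injEq] at h
    obtain ⟨rfl, rfl, rfl⟩ := h
    cases a <;> simp

theorem existsUnique_and_exists_eq_iff {α E : Type*} {A : E → Prop} {f : α → E}
    (hf : Function.Injective f) : (∃! e, A e ∧ ∃ b, f b = e) ↔ ∃! b, A (f b) := by
  constructor
  · rintro ⟨_, ⟨h, b, rfl⟩, hu⟩
    exact ⟨b, h, fun b' hb' => hf (hu _ ⟨hb', b', rfl⟩)⟩
  · rintro ⟨b, h, hu⟩
    refine ⟨f b, ⟨h, b, rfl⟩, ?_⟩
    rintro _ ⟨h', b', rfl⟩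
    rw [hu b' h']

open Classical in
theorem covers_whitePt_iff (n : ℕ) (h : Prop) (A : (ZMod n × ZMod n) × Bool × Bool → Bool)
    (γ : ZMod n × ZMod n) :
    ((¬h → ∃! e, A e = true ∧ (edgeWhite n e = whitePt n γ ∨ edgeBlack n e = whitePt n γ)) ∧
      (h → ∀ e, A e = true → ¬(edgeWhite n e = whitePt n γ ∨ edgeBlack n e = whitePt n γ))) ↔
    ¬(A (γ, true, true) = true ∧ A (γ, true, false) = true) ∧
      ¬(A (cellRight n γ, false, true) = true ∧ A (cellRight n γ, false, false) = true) ∧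
      (A (γ, true, true) || A (γ, true, false)).toNat +
        (A (cellRight n γ, false, true) || A (cellRight n γ, false, false)).toNat +
        (if h then 1 else 0) = 1 := by
  have hne : ∀ e, edgeBlack n e ≠ whitePt n γ := fun e he => whitePt_ne_blackPt n _ _ he.symm
  have hinj : Function.Injective fun b : Bool × Bool =>
      ((if b.1 then γ else cellRight n γ), b.1, b.2) := by
    rintro ⟨a, b⟩ ⟨a', b'⟩ h; simpa using (Prod.ext_iff.1 h).2
  have h1 := existsUnique_bool_iff fun a b => A ((if a then γ else cellRight n γ), a, b)
  have h2 := forall_bool_not_iff fun a b => A ((if a then γ else cellRight n γ), a, b)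
  simp only [if_true, Bool.false_eq_true, if_false] at h1 h2
  simp only [hne, or_false, edgeWhite_eq_iff]
  by_cases hh : h
  · simp only [hh, not_true_eq_false, false_imp_iff, true_and, true_imp_iff, if_true,
      Nat.add_eq_right, ← h2]
    constructor
    · exact fun H b hb => H _ hb ⟨b, rfl⟩
    · rintro H _ hA ⟨b, rfl⟩
      exact H b hA
  · simp only [hh, not_false_eq_true, true_imp_iff, false_imp_iff, and_true, if_false, add_zero,
      ← h1]
    exact existsUnique_and_exists_eq_iff (A := fun e => A e = true) hinj

open Classical in
theorem covers_blackPt_iff (n : ℕ) (h : Prop) (A : (ZMod n × ZMod n) × Bool × Bool → Bool)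
    (γ : ZMod n × ZMod n) :
    ((¬h → ∃! e, A e = true ∧ (edgeWhite n e = blackPt n γ ∨ edgeBlack n e = blackPt n γ)) ∧
      (h → ∀ e, A e = true → ¬(edgeWhite n e = blackPt n γ ∨ edgeBlack n e = blackPt n γ))) ↔
    ¬(A (γ, true, true) = true ∧ A (γ, false, true) = true) ∧
      ¬(A (cellDown n γ, true, false) = true ∧ A (cellDown n γ, false, false) = true) ∧
      (A (γ, true, true) || A (γ, false, true)).toNat +
        (A (cellDown n γ, true, false) || A (cellDown n γ, false, false)).toNat +
        (if h then 1 else 0) = 1 := by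
  have hne : ∀ e, edgeWhite n e ≠ blackPt n γ := fun e => whitePt_ne_blackPt n _ _
  have hinj : Function.Injective fun b : Bool × Bool =>
      ((if b.1 then γ else cellDown n γ), b.2, b.1) := by
    rintro ⟨a, b⟩ ⟨a', b'⟩ h; simpa [and_comm] using (Prod.ext_iff.1 h).2
  have h1 := existsUnique_bool_iff fun a b => A ((if a then γ else cellDown n γ), b, a)
  have h2 := forall_bool_not_iff fun a b => A ((if a then γ else cellDown n γ), b, a)
  simp only [if_true, Bool.false_eq_true, if_false] at h1 h2
  simp only [hne, false_or, edgeBlack_eq_iff]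
  by_cases hh : h
  · simp only [hh, not_true_eq_false, false_imp_iff, true_and, true_imp_iff, if_true,
      Nat.add_eq_right, ← h2]
    constructor
    · exact fun H b hb => H _ hb ⟨b, rfl⟩
    · rintro H _ hA ⟨b, rfl⟩
      exact H b hA
  · simp only [hh, not_false_eq_true, true_imp_iff, false_imp_iff, and_true, if_false, add_zero,
      ← h1]
    exact existsUnique_and_exists_eq_iff (A := fun e => A e = true) hinj

open Classical in
/-- Indicator of the white vertices in `S`, numbered by cells. -/
noncomputable def whiteInd (n : ℕ) (S : Set (ZMod (2 * n) × ZMod (2 * n))) (γ : ZMod n × ZMod n) :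
    ℕ :=
  if whitePt n γ ∈ S then 1 else 0

open Classical in
/-- Indicator of the black vertices in `S`, numbered by cells. -/
noncomputable def blackInd (n : ℕ) (S : Set (ZMod (2 * n) × ZMod (2 * n))) (γ : ZMod n × ZMod n) :
    ℕ :=
  if blackPt n γ ∈ S then 1 else 0

theorem covers_iff (n : ℕ) (S : Set (ZMod (2 * n) × ZMod (2 * n)))
    (A : (ZMod n × ZMod n) × Bool × Bool → Bool) :
    (∀ v, (v ∈ torusVertices n n \ S →
        ∃! e, A e = true ∧ (edgeWhite n e = v ∨ edgeBlack n e = v)) ∧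
      (v ∉ torusVertices n n \ S → ∀ e, A e = true → ¬(edgeWhite n e = v ∨ edgeBlack n e = v))) ↔
    (∀ γ, CellState.Disjoint fun σ τ => A (γ, σ, τ)) ∧
      FlagsCover (cellRight n) (cellDown n) (whiteInd n S) (blackInd n S)
        fun γ => CellState.flags fun σ τ => A (γ, σ, τ) := by
  have hw : ∀ γ, whitePt n γ ∈ torusVertices n n \ S ↔ ¬whitePt n γ ∈ S := fun γ => by
    simp [mem_torusVertices_iff]
  have hb : ∀ γ, blackPt n γ ∈ torusVertices n n \ S ↔ ¬blackPt n γ ∈ S := fun γ => by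
    simp [mem_torusVertices_iff]
  constructor
  · intro H
    have HW := fun γ => (covers_whitePt_iff n (whitePt n γ ∈ S) A γ).1 (by
      have := H (whitePt n γ); rwa [hw, not_not] at this)
    have HB := fun γ => (covers_blackPt_iff n (blackPt n γ ∈ S) A γ).1 (by
      have := H (blackPt n γ); rwa [hb, not_not] at this)
    refine ⟨fun γ => ⟨fun σ => ?_, fun τ => ?_⟩, fun γ => (HW γ).2.2, fun γ => (HB γ).2.2⟩
    · cases σ
      -- The white vertex on the `false` side of `γ` is numbered by the cell to the left.
      · simpa using (HW ((cellRight n).symm γ)).2.1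
      · exact (HW γ).1
    · cases τ
      · simpa using (HB ((cellDown n).symm γ)).2.1
      · exact (HB γ).1
  · rintro ⟨hd, hcw, hcb⟩ v
    by_cases hv : v ∈ torusVertices n n
    · rcases (mem_torusVertices_iff n v).1 hv with ⟨γ, rfl⟩ | ⟨γ, rfl⟩
      · rw [hw, not_not]
        exact (covers_whitePt_iff n _ A γ).2 ⟨(hd γ).1 true, (hd _).1 false, hcw γ⟩
      · rw [hb, not_not]
        exact (covers_blackPt_iff n _ A γ).2 ⟨(hd γ).2 true, (hd _).2 false, hcb γ⟩
    · refine ⟨fun h => absurd h.1 hv, ?_⟩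
      rintro - e - (rfl | rfl) <;> apply hv <;> rw [mem_torusVertices_iff]
      · exact Or.inl ⟨_, rfl⟩
      · exact Or.inr ⟨_, rfl⟩

theorem numMatchings_torusMinus {n : ℕ} [NeZero n] (hn : 2 ≤ n) (S : Finset (ℤ × ℤ)) :
    numMatchings (torusMinus n n S) =
      (edgeConfigs (cellRight n) (cellDown n) (whiteInd n (toTorus n n '' (S : Set (ℤ × ℤ))))
        (blackInd n (toTorus n n '' (S : Set (ℤ × ℤ))))).card := by
  classical
  rw [numMatchings, torusMinus, card_isPerfectMatching_induce (cornerGraph n n) _ (edgeWhite n)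
    (edgeBlack n) (edge_injective hn) (fun e e' => whitePt_ne_blackPt n _ _)
    (fun u hu v _ => cornerGraph_adj_iff n u v hu.1), ← Fintype.card_coe,
    ← Nat.card_eq_fintype_card]
  refine Nat.card_congr (Equiv.subtypeEquiv
    { toFun := fun A γ σ τ => A (γ, σ, τ)
      invFun := fun A e => A e.1 e.2.1 e.2.2
      left_inv := fun _ => rfl
      right_inv := fun _ => rfl } fun A => ?_)
  rw [covers_iff]
  simp [edgeConfigs]

/-! ### Holes in the plane and their complementary holes -/

/-- The points `(a + 2 s, b + 2 t)` with `s < m` and `t < n`. -/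
def evenGrid (a b : ℤ) (m n : ℕ) : Finset (ℤ × ℤ) :=
  (Finset.range m ×ˢ Finset.range n).image fun q => (a + 2 * (q.1 : ℤ), b + 2 * (q.2 : ℤ))

theorem card_evenGrid (a b : ℤ) (m n : ℕ) : (evenGrid a b m n).card = m * n := by
  rw [evenGrid, Finset.card_image_of_injective, Finset.card_product, Finset.card_range,
    Finset.card_range]
  rintro ⟨s, t⟩ ⟨s', t'⟩ h
  simpa using h

theorem mem_evenGrid {a b : ℤ} {m n : ℕ} {p : ℤ × ℤ} : p ∈ evenGrid a b m n ↔
    (a ≤ p.1 ∧ p.1 < a + 2 * m ∧ (p.1 - a) % 2 = 0) ∧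
      b ≤ p.2 ∧ p.2 < b + 2 * n ∧ (p.2 - b) % 2 = 0 := by
  simp only [evenGrid, Finset.mem_image, Finset.mem_product, Finset.mem_range, Prod.exists]
  constructor
  · rintro ⟨s, t, ⟨hs, ht⟩, rfl⟩
    dsimp only
    omega
  · intro h
    refine ⟨((p.1 - a) / 2).toNat, ((p.2 - b) / 2).toNat, by omega, Prod.ext ?_ ?_⟩ <;>
      dsimp only <;> omega

theorem mem_oddAztecRect {k l : ℕ} {c p : ℤ × ℤ} : p ∈ oddAztecRect k l c ↔
    ((c.1 - k ≤ p.1 ∧ p.1 ≤ c.1 + k) ∧ c.2 - l ≤ p.2 ∧ p.2 ≤ c.2 + l) ∧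
      ((p.1 - (c.1 - k)) + (p.2 - (c.2 - l))) % 2 = 0 := by
  simp only [oddAztecRect, Finset.mem_filter, Finset.mem_product, Finset.mem_Icc, Int.even_iff]

theorem isCentre_iff {k l : ℕ} {c : ℤ × ℤ} :
    IsCentre k l c ↔ (c.1 - k + (c.2 - l)) % 2 = 1 := by
  simp only [IsCentre, Int.odd_iff]

/-- The rectangle splits into the grid containing the corners (even row offset) and the interior
grid (odd row offset). Stating this for a residue `e` serves both colours and both placements. -/
theorem card_oddAztecRect_filter {k l : ℕ} {c : ℤ × ℤ} (P : ℤ × ℤ → Prop) [DecidablePred P]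
    (e : ℤ) (hP : ∀ p ∈ oddAztecRect k l c, P p ↔ (p.1 - (c.1 - k)) % 2 = e) :
    ((oddAztecRect k l c).filter P).card =
      if e = 0 then (k + 1) * (l + 1) else if e = 1 then k * l else 0 := by
  split_ifs with h0 h1
  · rw [← card_evenGrid (c.1 - k) (c.2 - l)]
    congr 1
    ext p
    rw [Finset.mem_filter, mem_evenGrid]
    constructor
    · rintro ⟨hp, h⟩
      rw [hP p hp] at h
      rw [mem_oddAztecRect] at hp
      push_cast
      omega
    · intro h
      have hp : p ∈ oddAztecRect k l c := by
        rw [mem_oddAztecRect]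
        push_cast at h
        omega
      exact ⟨hp, (hP p hp).2 (by omega)⟩
  · rw [← card_evenGrid (c.1 - k + 1) (c.2 - l + 1)]
    congr 1
    ext p
    rw [Finset.mem_filter, mem_evenGrid]
    constructor
    · rintro ⟨hp, h⟩
      rw [hP p hp] at h
      rw [mem_oddAztecRect] at hp
      omega
    · intro h
      have hp : p ∈ oddAztecRect k l c := by
        rw [mem_oddAztecRect]
        omega
      exact ⟨hp, (hP p hp).2 (by omega)⟩
  · rw [Finset.card_eq_zero, Finset.filter_eq_empty_iff]
    intro p hp h
    rw [hP p hp] at h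
    omega

theorem isVertex_of_mem_oddAztecRect {k l : ℕ} {c : ℤ × ℤ} (hc : IsCentre k l c) {p : ℤ × ℤ}
    (hp : p ∈ oddAztecRect k l c) : IsVertex p := by
  rw [isCentre_iff] at hc
  rw [mem_oddAztecRect] at hp
  rw [IsVertex, Int.odd_iff]
  omega

theorem card_oddAztecRect_white {k l : ℕ} {c : ℤ × ℤ} (hc : IsCentre k l c) :
    ((oddAztecRect k l c).filter IsWhite).card =
      if (c.1 - k) % 2 = 0 then (k + 1) * (l + 1) else k * l := by
  rw [card_oddAztecRect_filter IsWhite ((c.1 - k) % 2)]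
  · rcases Int.emod_two_eq_zero_or_one (c.1 - k) with h | h <;> simp [h]
  · intro p hp
    simp only [IsWhite, isVertex_of_mem_oddAztecRect hc hp, true_and, Int.even_iff]
    omega

theorem card_oddAztecRect_black {k l : ℕ} {c : ℤ × ℤ} (hc : IsCentre k l c) :
    ((oddAztecRect k l c).filter IsBlack).card =
      if (c.1 - k) % 2 = 0 then k * l else (k + 1) * (l + 1) := by
  rw [card_oddAztecRect_filter IsBlack (1 - (c.1 - k) % 2)]
  · rcases Int.emod_two_eq_zero_or_one (c.1 - k) with h | h <;> simp [h]
  · intro p hp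
    simp only [IsBlack, isVertex_of_mem_oddAztecRect hc hp, true_and, Int.odd_iff]
    omega

/-- Up to sign the charge depends only on `k + l`, so shapes with equal sum interact with the same
exponent. -/
theorem charge_oddAztecRect {k l : ℕ} {c : ℤ × ℤ} (hc : IsCentre k l c) :
    charge (oddAztecRect k l c) = if (c.1 - k) % 2 = 0 then (k + l + 1 : ℤ) else -(k + l + 1) := by
  rw [charge, card_oddAztecRect_white hc, card_oddAztecRect_black hc]
  split_ifs <;> push_cast <;> ring

theorem card_eq_white_add_black {S : Finset (ℤ × ℤ)} (hS : ∀ p ∈ S, IsVertex p) :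
    S.card = (S.filter IsWhite).card + (S.filter IsBlack).card := by
  have h : S.filter IsBlack = S.filter fun p => ¬IsWhite p := by
    refine Finset.filter_congr fun p hp => ?_
    simp only [IsBlack, IsWhite, hS p hp, true_and, Int.not_even_iff_odd]
  rw [h, Finset.card_filter_add_card_filter_not]

theorem card_oddAztecRect {k l : ℕ} {c : ℤ × ℤ} (hc : IsCentre k l c) :
    (oddAztecRect k l c).card = (k + 1) * (l + 1) + k * l := by
  rw [card_eq_white_add_black fun p => isVertex_of_mem_oddAztecRect hc,
    card_oddAztecRect_white hc, card_oddAztecRect_black hc]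
  split_ifs <;> ring

/-- The relation between two systems of holes `S`, `S'` in the plane that are exchanged by
complementation, `B` being the set of the cells that are left empty. -/
structure PlanarComplementary (S S' B : Finset (ℤ × ℤ)) : Prop where
  white : ∀ x y : ℤ, ((if (2 * x, 2 * y + 1) ∈ S then 1 else 0) +
    (if (2 * x, 2 * y + 1) ∈ S' then 1 else 0) : ℕ) =
    (if (2 * x, 2 * y) ∈ B then 1 else 0) + if (2 * x, 2 * y + 2) ∈ B then 1 else 0
  black : ∀ x y : ℤ, ((if (2 * x + 1, 2 * y) ∈ S then 1 else 0) +
    (if (2 * x + 1, 2 * y) ∈ S' then 1 else 0) : ℕ) =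
    (if (2 * x, 2 * y) ∈ B then 1 else 0) + if (2 * x + 2, 2 * y) ∈ B then 1 else 0
  cell : ∀ x y : ℤ, (2 * x, 2 * y) ∈ B →
    ((2 * x, 2 * y + 1) ∈ S ∧ (2 * x, 2 * y - 1) ∈ S ∧
      (2 * x + 1, 2 * y) ∈ S' ∧ (2 * x - 1, 2 * y) ∈ S') ∨
    ((2 * x + 1, 2 * y) ∈ S ∧ (2 * x - 1, 2 * y) ∈ S ∧
      (2 * x, 2 * y + 1) ∈ S' ∧ (2 * x, 2 * y - 1) ∈ S')

theorem PlanarComplementary.symm {S S' B : Finset (ℤ × ℤ)} (h : PlanarComplementary S S' B) :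
    PlanarComplementary S' S B where
  white x y := by rw [add_comm, h.white]
  black x y := by rw [add_comm, h.black]
  cell x y hB := by have := h.cell x y hB; tauto

theorem ite_mem_union {α : Type*} [DecidableEq α] {S T : Finset α} (h : Disjoint S T) (p : α) :
    (if p ∈ S ∪ T then 1 else 0 : ℕ) = (if p ∈ S then 1 else 0) + if p ∈ T then 1 else 0 := by
  have : p ∈ S → p ∉ T := fun h1 h2 => Finset.disjoint_left.1 h h1 h2
  by_cases h1 : p ∈ S <;> by_cases h2 : p ∈ T <;> simp_all

theorem PlanarComplementary.union {S₁ S₁' B₁ S₂ S₂' B₂ : Finset (ℤ × ℤ)}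
    (h₁ : PlanarComplementary S₁ S₁' B₁) (h₂ : PlanarComplementary S₂ S₂' B₂)
    (hS : Disjoint S₁ S₂) (hS' : Disjoint S₁' S₂') (hB : Disjoint B₁ B₂) :
    PlanarComplementary (S₁ ∪ S₂) (S₁' ∪ S₂') (B₁ ∪ B₂) where
  white x y := by
    simp only [ite_mem_union hS, ite_mem_union hS', ite_mem_union hB]
    have := h₁.white x y
    have := h₂.white x y
    omega
  black x y := by
    simp only [ite_mem_union hS, ite_mem_union hS', ite_mem_union hB]
    have := h₁.black x y
    have := h₂.black x y
    omega
  cell x y h := by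
    simp only [Finset.mem_union] at h ⊢
    rcases h with h | h
    · have := h₁.cell x y h; tauto
    · have := h₂.cell x y h; tauto

/-- The white-placed hole `O_{k,l+1}` is complementary to the black-placed hole `O_{k+1,l}`. -/
theorem planarComplementary_oddAztecRect {k l : ℕ} {c : ℤ × ℤ} (hc : IsCentre k (l + 1) c)
    (hw : (c.1 - k) % 2 = 0) :
    PlanarComplementary (oddAztecRect k (l + 1) c) (oddAztecRect (k + 1) l c)
      (evenGrid (c.1 - k) (c.2 - l) (k + 1) (l + 1)) := by
  rw [isCentre_iff] at hc
  push_cast at hc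
  constructor
  · intro x y
    simp only [mem_oddAztecRect, mem_evenGrid]
    push_cast
    split_ifs <;> omega
  · intro x y
    simp only [mem_oddAztecRect, mem_evenGrid]
    push_cast
    split_ifs <;> omega
  · intro x y
    simp only [mem_oddAztecRect, mem_evenGrid]
    push_cast
    intro h
    -- The cells of `B` have their white neighbours in the first hole and their black neighbours in
    -- the second.
    left
    omega

/-! ### Transfer to a large torus -/

theorem exists_bound (S : Finset (ℤ × ℤ)) : ∃ R : ℕ, ∀ p ∈ S, p.1.natAbs ≤ R ∧ p.2.natAbs ≤ R := by
  refine ⟨S.sup fun p => max p.1.natAbs p.2.natAbs, fun p hp => ?_⟩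
  have := Finset.le_sup (f := fun p : ℤ × ℤ => max p.1.natAbs p.2.natAbs) hp
  simp only [max_le_iff] at this
  omega

theorem toTorus_eq_of_bound {n : ℕ} {p q : ℤ × ℤ} (h : toTorus n n p = toTorus n n q)
    (h1 : p.1.natAbs + q.1.natAbs < 2 * n) (h2 : p.2.natAbs + q.2.natAbs < 2 * n) : p = q := by
  simp only [toTorus, Prod.mk.injEq, ZMod.intCast_eq_intCast_iff_dvd_sub] at h
  refine Prod.ext ?_ ?_
  · have := Int.eq_zero_of_abs_lt_dvd h.1 (by simp only [Int.abs_eq_natAbs]; omega)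
    omega
  · have := Int.eq_zero_of_abs_lt_dvd h.2 (by simp only [Int.abs_eq_natAbs]; omega)
    omega

/-- The squares of `S` are close to the origin, compared with the size of the torus. -/
def Fits (n : ℕ) (S : Finset (ℤ × ℤ)) : Prop := ∀ p ∈ S, p.1.natAbs + 3 ≤ n ∧ p.2.natAbs + 3 ≤ n

theorem eventually_fits (S : Finset (ℤ × ℤ)) : ∀ᶠ n : ℕ in atTop, Fits n S := by
  obtain ⟨R, hR⟩ := exists_bound S
  filter_upwards [eventually_ge_atTop (R + 3)] with n hn p hp
  have := hR p hp
  omega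

/-- The margin 3 in `Fits` is what is needed: cells have representatives with coordinates at most
`n` in absolute value, their neighbouring vertices and cells stay within `n + 2`, and `(n + 2) + (n
- 3) < 2n` excludes wrap-around. -/
theorem Fits.mem_image_iff {n : ℕ} {S : Finset (ℤ × ℤ)} (hS : Fits n S) {p : ℤ × ℤ}
    (h1 : p.1.natAbs ≤ n + 2) (h2 : p.2.natAbs ≤ n + 2) :
    toTorus n n p ∈ toTorus n n '' (S : Set (ℤ × ℤ)) ↔ p ∈ S := by
  constructor
  · rintro ⟨q, hq, h⟩
    have := hS q hq
    rwa [← toTorus_eq_of_bound h (by omega) (by omega)]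
  · exact fun h => ⟨p, h, rfl⟩

theorem exists_int_of_zmod (n : ℕ) [NeZero n] (γ : ZMod n × ZMod n) :
    ∃ x y : ℤ, ((x : ZMod n), (y : ZMod n)) = γ ∧ (2 * x).natAbs ≤ n ∧ (2 * y).natAbs ≤ n := by
  have h1 := γ.1.valMinAbs_mem_Ioc
  have h2 := γ.2.valMinAbs_mem_Ioc
  rw [Set.mem_Ioc] at h1 h2
  exact ⟨γ.1.valMinAbs, γ.2.valMinAbs, by simp [ZMod.coe_valMinAbs], by omega, by omega⟩

open Classical in
/-- Indicator of the cells in `B`. -/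
noncomputable def cellInd (n : ℕ) (B : Set (ZMod (2 * n) × ZMod (2 * n))) (γ : ZMod n × ZMod n) :
    ℕ :=
  if (dbl n γ.1, dbl n γ.2) ∈ B then 1 else 0

theorem toTorus_cell (n : ℕ) (x y : ℤ) :
    toTorus n n (2 * x, 2 * y) = (dbl n (x : ZMod n), dbl n (y : ZMod n)) := by
  simp only [toTorus, dbl_intCast]

theorem Fits.whiteInd_eq {n : ℕ} {S : Finset (ℤ × ℤ)} (hS : Fits n S) {x y : ℤ}
    (h1 : (2 * x).natAbs ≤ n) (h2 : (2 * y + 1).natAbs ≤ n + 2) :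
    whiteInd n (toTorus n n '' (S : Set (ℤ × ℤ))) ((x : ZMod n), (y : ZMod n)) =
      if (2 * x, 2 * y + 1) ∈ S then 1 else 0 := by
  simp only [whiteInd, ← toTorus_white,
    hS.mem_image_iff (p := (2 * x, 2 * y + 1)) (by dsimp only; omega) h2]

theorem Fits.blackInd_eq {n : ℕ} {S : Finset (ℤ × ℤ)} (hS : Fits n S) {x y : ℤ}
    (h1 : (2 * x + 1).natAbs ≤ n + 2) (h2 : (2 * y).natAbs ≤ n) :
    blackInd n (toTorus n n '' (S : Set (ℤ × ℤ))) ((x : ZMod n), (y : ZMod n)) =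
      if (2 * x + 1, 2 * y) ∈ S then 1 else 0 := by
  simp only [blackInd, ← toTorus_black,
    hS.mem_image_iff (p := (2 * x + 1, 2 * y)) h1 (by dsimp only; omega)]

theorem Fits.cellInd_eq {n : ℕ} {S : Finset (ℤ × ℤ)} (hS : Fits n S) {x y : ℤ}
    (h1 : (2 * x).natAbs ≤ n + 2) (h2 : (2 * y).natAbs ≤ n + 2) :
    cellInd n (toTorus n n '' (S : Set (ℤ × ℤ))) ((x : ZMod n), (y : ZMod n)) =
      if (2 * x, 2 * y) ∈ S then 1 else 0 := by
  simp only [cellInd, ← toTorus_cell, hS.mem_image_iff (p := (2 * x, 2 * y)) h1 h2]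

theorem cellRight_intCast (n : ℕ) (x y : ℤ) : cellRight n ((x : ZMod n), (y : ZMod n)) =
    ((x : ZMod n), ((y + 1 : ℤ) : ZMod n)) := by
  simp [cellRight]

theorem cellRight_symm_intCast (n : ℕ) (x y : ℤ) :
    (cellRight n).symm ((x : ZMod n), (y : ZMod n)) = ((x : ZMod n), ((y - 1 : ℤ) : ZMod n)) := by
  simp [cellRight, sub_eq_add_neg]

theorem cellDown_intCast (n : ℕ) (x y : ℤ) : cellDown n ((x : ZMod n), (y : ZMod n)) =
    (((x + 1 : ℤ) : ZMod n), (y : ZMod n)) := by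
  simp [cellDown]

theorem cellDown_symm_intCast (n : ℕ) (x y : ℤ) :
    (cellDown n).symm ((x : ZMod n), (y : ZMod n)) = (((x - 1 : ℤ) : ZMod n), (y : ZMod n)) := by
  simp [cellDown, sub_eq_add_neg]

theorem PlanarComplementary.torus {S S' B : Finset (ℤ × ℤ)} (h : PlanarComplementary S S' B)
    {n : ℕ} [NeZero n] (hS : Fits n S) (hS' : Fits n S') (hB : Fits n B) :
    Complementary (cellRight n) (cellDown n)
      (whiteInd n (toTorus n n '' (S : Set (ℤ × ℤ))))
      (blackInd n (toTorus n n '' (S : Set (ℤ × ℤ))))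
      (whiteInd n (toTorus n n '' (S' : Set (ℤ × ℤ))))
      (blackInd n (toTorus n n '' (S' : Set (ℤ × ℤ))))
      (cellInd n (toTorus n n '' (B : Set (ℤ × ℤ)))) := by
  constructor
  · intro γ
    obtain ⟨x, y, rfl, hx, hy⟩ := exists_int_of_zmod n γ
    rw [cellRight_intCast, hS.whiteInd_eq hx (by omega), hS'.whiteInd_eq hx (by omega),
      hB.cellInd_eq (by omega) (by omega), hB.cellInd_eq (by omega) (by omega), h.white, mul_add]
    rfl
  · intro γ
    obtain ⟨x, y, rfl, hx, hy⟩ := exists_int_of_zmod n γ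
    rw [cellDown_intCast, hS.blackInd_eq (by omega) hy, hS'.blackInd_eq (by omega) hy,
      hB.cellInd_eq (by omega) (by omega), hB.cellInd_eq (by omega) (by omega), h.black, mul_add]
    rfl
  · intro γ
    obtain ⟨x, y, rfl, hx, hy⟩ := exists_int_of_zmod n γ
    rw [cellRight_symm_intCast, cellDown_symm_intCast, hB.cellInd_eq (by omega) (by omega),
      hS.whiteInd_eq hx (by omega), hS.whiteInd_eq hx (by omega),
      hS'.whiteInd_eq hx (by omega), hS'.whiteInd_eq hx (by omega),
      hS.blackInd_eq (by omega) hy, hS.blackInd_eq (by omega) hy,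
      hS'.blackInd_eq (by omega) hy, hS'.blackInd_eq (by omega) hy]
    by_cases hc : (2 * x, 2 * y) ∈ B
    · have := h.cell x y hc
      rw [show 2 * (x - 1) + 1 = 2 * x - 1 by ring, show 2 * (y - 1) + 1 = 2 * y - 1 by ring]
      simpa [hc] using this
    · simp [hc]

/-- Common count for white vertices, black vertices and cells: `g` parametrizes the class `P` in the
plane and `f` is its reduction to the torus. -/
theorem sum_ite_mem_image {n : ℕ} [NeZero n] {S : Finset (ℤ × ℤ)} (hS : Fits n S)
    (P : ℤ × ℤ → Prop) [DecidablePred P] (f : ZMod n × ZMod n → ZMod (2 * n) × ZMod (2 * n))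
    (g : ℤ × ℤ → ℤ × ℤ)
    (hf : ∀ x y : ℤ, f ((x : ZMod n), (y : ZMod n)) = toTorus n n (g (x, y)))
    (hfi : Function.Injective f)
    (hg : ∀ x y : ℤ, P (g (x, y)) ∧
      ((g (x, y)).1).natAbs ≤ (2 * x).natAbs + 1 ∧ ((g (x, y)).2).natAbs ≤ (2 * y).natAbs + 1)
    (hP : ∀ p, P p → ∃ q, g q = p) [DecidablePred fun γ => f γ ∈ toTorus n n '' (S : Set (ℤ × ℤ))] :
    (∑ γ, if f γ ∈ toTorus n n '' (S : Set (ℤ × ℤ)) then 1 else 0 : ℕ) = (S.filter P).card := by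
  rw [← Finset.card_filter]
  symm
  choose i hi using hP
  refine Finset.card_bij (fun p hp => (((i p (Finset.mem_filter.1 hp).2).1 : ZMod n),
    ((i p (Finset.mem_filter.1 hp).2).2 : ZMod n))) ?_ ?_ ?_
  · intro p hp
    simp only [Finset.mem_filter, Finset.mem_univ, true_and]
    rw [hf, hi]
    exact ⟨p, (Finset.mem_filter.1 hp).1, rfl⟩
  · intro p hp q hq h
    have := congrArg f h
    rw [hf, hf, hi, hi] at this
    have h1 := hS p (Finset.mem_filter.1 hp).1
    have h2 := hS q (Finset.mem_filter.1 hq).1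
    exact toTorus_eq_of_bound this (by omega) (by omega)
  · intro γ hγ
    obtain ⟨x, y, rfl, hx, hy⟩ := exists_int_of_zmod n γ
    obtain ⟨hPg, h1, h2⟩ := hg x y
    simp only [Finset.mem_filter, Finset.mem_univ, true_and] at hγ
    rw [hf, hS.mem_image_iff (by omega) (by omega)] at hγ
    refine ⟨g (x, y), Finset.mem_filter.2 ⟨hγ, hPg⟩, hfi ?_⟩
    rw [hf, hi, hf]

theorem sum_whiteInd {n : ℕ} [NeZero n] {S : Finset (ℤ × ℤ)} (hS : Fits n S) :
    ∑ γ, whiteInd n (toTorus n n '' (S : Set (ℤ × ℤ))) γ = (S.filter IsWhite).card := by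
  classical
  unfold whiteInd
  refine sum_ite_mem_image hS IsWhite (whitePt n) (fun p => (2 * p.1, 2 * p.2 + 1))
    (fun x y => (toTorus_white n x y).symm) (whitePt_injective n) (fun x y => ?_) fun p hp => ?_
  · refine ⟨⟨⟨x + y, by ring⟩, ⟨x, by ring⟩⟩, ?_, ?_⟩ <;> dsimp only <;> omega
  · obtain ⟨h1, h2⟩ := hp
    rw [IsVertex, Int.odd_iff] at h1
    rw [Int.even_iff] at h2
    exact ⟨(p.1 / 2, p.2 / 2), Prod.ext (by dsimp only; omega) (by dsimp only; omega)⟩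

theorem sum_blackInd {n : ℕ} [NeZero n] {S : Finset (ℤ × ℤ)} (hS : Fits n S) :
    ∑ γ, blackInd n (toTorus n n '' (S : Set (ℤ × ℤ))) γ = (S.filter IsBlack).card := by
  classical
  unfold blackInd
  refine sum_ite_mem_image hS IsBlack (blackPt n) (fun p => (2 * p.1 + 1, 2 * p.2))
    (fun x y => (toTorus_black n x y).symm) (blackPt_injective n) (fun x y => ?_) fun p hp => ?_
  · refine ⟨⟨⟨x + y, by ring⟩, ⟨x, by ring⟩⟩, ?_, ?_⟩ <;> dsimp only <;> omega
  · obtain ⟨h1, h2⟩ := hp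
    rw [IsVertex, Int.odd_iff] at h1
    rw [Int.odd_iff] at h2
    exact ⟨(p.1 / 2, p.2 / 2), Prod.ext (by dsimp only; omega) (by dsimp only; omega)⟩

theorem sum_cellInd {n : ℕ} [NeZero n] {B : Finset (ℤ × ℤ)} (hB : Fits n B)
    (he : ∀ p ∈ B, Even p.1 ∧ Even p.2) :
    ∑ γ, cellInd n (toTorus n n '' (B : Set (ℤ × ℤ))) γ = B.card := by
  classical
  unfold cellInd
  rw [sum_ite_mem_image hB (fun p => Even p.1 ∧ Even p.2)
    (fun γ => (dbl n γ.1, dbl n γ.2)) (fun p => (2 * p.1, 2 * p.2))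
    (fun x y => (toTorus_cell n x y).symm), Finset.filter_true_of_mem he]
  · rintro ⟨a, b⟩ ⟨a', b'⟩ h
    simp only [Prod.mk.injEq] at h
    rw [dbl_injective n h.1, dbl_injective n h.2]
  · intro x y
    refine ⟨⟨⟨x, by ring⟩, ⟨y, by ring⟩⟩, ?_, ?_⟩ <;> dsimp only <;> omega
  · rintro p ⟨⟨a, ha⟩, ⟨b, hb⟩⟩
    exact ⟨(a, b), Prod.ext (by dsimp only; omega) (by dsimp only; omega)⟩

theorem PlanarComplementary.numMatchings_eq {S S' B : Finset (ℤ × ℤ)}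
    (h : PlanarComplementary S S' B) (hv : ∀ p ∈ S, IsVertex p)
    (he : ∀ p ∈ B, Even p.1 ∧ Even p.2) : ∀ᶠ n : ℕ in atTop,
      (numMatchings (torusMinus n n S) : ℝ) * √2 ^ S.card =
        (numMatchings (torusMinus n n S') : ℝ) * 2 ^ B.card := by
  filter_upwards [eventually_fits S, eventually_fits S', eventually_fits B,
    eventually_ge_atTop 2] with n hS hS' hB hn
  have : NeZero n := ⟨by omega⟩
  have := card_edgeConfigs_complement (h.torus hS hS' hB)
  rwa [← numMatchings_torusMinus hn, ← numMatchings_torusMinus hn, Finset.sum_add_distrib,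
    sum_whiteInd hS, sum_blackInd hS, ← card_eq_white_add_black hv, sum_cellInd hB he] at this

/-! ### Simultaneous exchange of two separated holes -/

theorem disjoint_of_row_lt {S T : Finset (ℤ × ℤ)} (a : ℤ) (hS : ∀ p ∈ S, p.1 < a)
    (hT : ∀ p ∈ T, a ≤ p.1) : Disjoint S T :=
  Finset.disjoint_left.2 fun p h1 h2 => by
    have := hS p h1
    have := hT p h2
    omega

theorem disjoint_oddAztecRect {k l k' l' : ℕ} {c c' : ℤ × ℤ} (h : c.1 + k < c'.1 - k') :
    Disjoint (oddAztecRect k l c) (oddAztecRect k' l' c') := by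
  refine disjoint_of_row_lt (c'.1 - k') (fun p hp => ?_) fun p hp => ?_ <;>
    rw [mem_oddAztecRect] at hp <;> omega

theorem numMatchings_two_holes {k l : ℕ} {c c' : ℤ × ℤ} (hc : IsCentre k (l + 1) c)
    (hw : (c.1 - k) % 2 = 0) (hc' : IsCentre (l + 1) k c') (hw' : (c'.1 - l) % 2 = 0)
    (hsep : c.1 + 2 * (k + l + 3) ≤ c'.1) : ∀ᶠ n : ℕ in atTop,
      (numMatchings (torusMinus n n
        (oddAztecRect k (l + 1) c ∪ oddAztecRect (l + 1) k c')) : ℝ) * 2 ^ k =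
      (numMatchings (torusMinus n n
        (oddAztecRect (k + 1) l c ∪ oddAztecRect l (k + 1) c')) : ℝ) * 2 ^ l := by
  have hc'' : IsCentre l (k + 1) c' := by
    rw [isCentre_iff] at hc' ⊢
    push_cast at hc' ⊢
    omega
  have hS := disjoint_oddAztecRect (k := k) (l := l + 1) (k' := l + 1) (l' := k) (c := c)
    (c' := c') (by push_cast; omega)
  have hS' := disjoint_oddAztecRect (k := k + 1) (l := l) (k' := l) (l' := k + 1) (c := c)
    (c' := c') (by push_cast; omega)
  have hB : Disjoint (evenGrid (c.1 - k) (c.2 - l) (k + 1) (l + 1))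
      (evenGrid (c'.1 - l) (c'.2 - k) (l + 1) (k + 1)) := by
    refine disjoint_of_row_lt (c.1 + (k + l + 3)) (fun p hp => ?_) fun p hp => ?_ <;>
      rw [mem_evenGrid] at hp <;> push_cast at hp <;> omega
  -- The second exchange runs backwards (black-placed to white-placed), which keeps the pair neutral
  -- on both sides.
  have h := (planarComplementary_oddAztecRect hc hw).union
    (planarComplementary_oddAztecRect hc'' hw').symm hS hS' hB
  refine (h.numMatchings_eq (fun p hp => ?_) fun p hp => ?_).mono fun n hn => ?_
  · rcases Finset.mem_union.1 hp with hp | hp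
    · exact isVertex_of_mem_oddAztecRect hc hp
    · exact isVertex_of_mem_oddAztecRect hc' hp
  · rw [isCentre_iff] at hc hc''
    rw [Int.even_iff, Int.even_iff]
    push_cast at hc hc''
    rcases Finset.mem_union.1 hp with hp | hp <;> rw [mem_evenGrid] at hp <;> omega
  -- The exponents of 2 are `|S| / 2` and `|B|`; their common part `2kl + 2k + l + 2` cancels,
  -- leaving `k` and `l`.
  · rw [Finset.card_union_of_disjoint hS, Finset.card_union_of_disjoint hB,
      card_oddAztecRect hc, card_oddAztecRect hc', card_evenGrid, card_evenGrid,
      show (k + 1) * (l + 1 + 1) + k * (l + 1) + ((l + 1 + 1) * (k + 1) + (l + 1) * k) =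
        2 * (k + (2 * k * l + 2 * k + l + 2)) by ring, pow_mul, Real.sq_sqrt (by norm_num),
      show (k + 1) * (l + 1) + (l + 1) * (k + 1) = l + (2 * k * l + 2 * k + l + 2) by ring,
      pow_add, pow_add _ l, ← mul_assoc, ← mul_assoc] at hn
    exact mul_right_cancel₀ (by positivity) hn

/-! ### Elementary properties of the correlation -/

theorem HasNeutralCorrelation.nonneg {S : Finset (ℤ × ℤ)} {a : ℝ} (h : HasNeutralCorrelation S a) :
    0 ≤ a :=
  ge_of_tendsto' h fun n => by unfold finiteCorrelation; positivity

theorem infinite_isWhite : {p : ℤ × ℤ | IsWhite p}.Infinite := by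
  refine Set.infinite_of_injective_forall_mem (f := fun n : ℤ => ((0 : ℤ), 2 * n + 1)) ?_ ?_
  · intro m n h
    simpa using h
  · intro n
    exact ⟨⟨n, by simp⟩, by simp⟩

theorem infinite_isBlack : {p : ℤ × ℤ | IsBlack p}.Infinite := by
  refine Set.infinite_of_injective_forall_mem (f := fun n : ℤ => ((1 : ℤ), 2 * n)) ?_ ?_
  · intro m n h
    simpa using h
  · intro n
    exact ⟨⟨n, by ring⟩, by simp⟩

theorem farAway_neBot (S : Finset (ℤ × ℤ)) :
    (farAway (if 0 < charge S then IsBlack else IsWhite)).NeBot := by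
  rw [farAway, cofinite_inf_principal_neBot_iff]
  split_ifs
  · exact infinite_isBlack
  · exact infinite_isWhite

theorem HasCorrelationOfCharge.nonneg {q : ℕ} {S : Finset (ℤ × ℤ)} {a : ℝ}
    (h : HasCorrelationOfCharge q S a) : 0 ≤ a := by
  induction q generalizing S a with
  | zero => exact HasNeutralCorrelation.nonneg h
  | succ q ih =>
    obtain ⟨μ, hμ, f, hf, ht⟩ := h
    have := farAway_neBot S
    refine ge_of_tendsto ht ?_
    filter_upwards [hf] with x hx
    have := ih hx
    have := hμ.1
    have : 0 ≤ gridDist 0 x := Real.sqrt_nonneg _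
    positivity

theorem correlation_spec {S : Finset (ℤ × ℤ)} (h : ∃ a, HasCorrelation S a) :
    HasCorrelation S (correlation S) := by
  rw [correlation, dif_pos h]
  exact h.choose_spec

theorem correlation_nonneg (S : Finset (ℤ × ℤ)) : 0 ≤ correlation S := by
  by_cases h : ∃ a, HasCorrelation S a
  · exact HasCorrelationOfCharge.nonneg (correlation_spec h)
  · rw [correlation, dif_neg h]

theorem charge_union {S T : Finset (ℤ × ℤ)} (h : Disjoint S T) :
    charge (S ∪ T) = charge S + charge T := by
  simp only [charge, Finset.filter_union,
    Finset.card_union_of_disjoint (Finset.disjoint_filter_filter h)]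
  push_cast
  ring

theorem charge_insert_black {S : Finset (ℤ × ℤ)} {x : ℤ × ℤ} (hx : IsBlack x) (hS : x ∉ S) :
    charge (insert x S) = charge S - 1 := by
  have : ¬IsWhite x := fun h => Int.not_even_iff_odd.2 hx.2 h.2
  rw [charge, charge, Finset.filter_insert, Finset.filter_insert, if_neg this, if_pos hx,
    Finset.card_insert_of_notMem (by simp [hS])]
  push_cast
  ring

theorem charge_insert_white {S : Finset (ℤ × ℤ)} {x : ℤ × ℤ} (hx : IsWhite x) (hS : x ∉ S) :
    charge (insert x S) = charge S + 1 := by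
  have : ¬IsBlack x := fun h => Int.not_even_iff_odd.2 h.2 hx.2
  rw [charge, charge, Finset.filter_insert, Finset.filter_insert, if_neg this, if_pos hx,
    Finset.card_insert_of_notMem (by simp [hS])]
  push_cast
  ring

/-! ### Distances -/

/-- A square as a complex number. -/
noncomputable def toComplex (p : ℤ × ℤ) : ℂ := (p.1 : ℝ) + (p.2 : ℝ) * Complex.I

theorem gridDist_eq_norm (p q : ℤ × ℤ) : gridDist p q = ‖toComplex p - toComplex q‖ / √2 := by
  rw [gridDist, Real.sqrt_div' _ (by norm_num : (0 : ℝ) ≤ 2), ← Complex.norm_add_mul_I]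
  congr 2
  simp only [toComplex]
  push_cast
  ring

theorem abs_row_sub_le (p q : ℤ × ℤ) : |((p.1 - q.1 : ℤ) : ℝ)| ≤ 2 * gridDist p q := by
  rw [gridDist]
  refine abs_le_of_sq_le_sq ?_ (by positivity)
  rw [mul_pow, Real.sq_sqrt (by positivity)]
  nlinarith [sq_nonneg ((p.1 - q.1 : ℤ) : ℝ), sq_nonneg ((p.2 - q.2 : ℤ) : ℝ)]

theorem gridDist_swap (p q : ℤ × ℤ) : gridDist p.swap q.swap = gridDist p q := by
  simp only [gridDist, Prod.fst_swap, Prod.snd_swap, add_comm]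

theorem abs_column_sub_le (p q : ℤ × ℤ) : |((p.2 - q.2 : ℤ) : ℝ)| ≤ 2 * gridDist p q := by
  rw [← gridDist_swap]
  exact abs_row_sub_le p.swap q.swap

theorem tendsto_gridDist_cofinite : Tendsto (gridDist 0) cofinite atTop := by
  have h : Tendsto (fun x : ℤ × ℤ => ‖x‖ / 2) cofinite atTop := by
    rw [← cocompact_eq_cofinite]
    exact (tendsto_norm_cocompact_atTop).atTop_div_const (by norm_num)
  refine tendsto_atTop_mono (fun x => ?_) h
  have h1 := abs_row_sub_le 0 x
  have h2 := abs_column_sub_le 0 x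
  rw [div_le_iff₀ (by norm_num), mul_comm, Prod.norm_def, max_le_iff, Int.norm_eq_abs,
    Int.norm_eq_abs]
  simp only [Prod.fst_zero, Prod.snd_zero, zero_sub, Int.cast_neg, abs_neg] at h1 h2
  exact ⟨h1, h2⟩

/-! ### Symmetries of the grid -/

/-- A symmetry of the grid graph that acts on all the tori and moves the origin by a bounded
distance only. -/
structure IsGridSymmetry (σ : ℤ × ℤ ≃ ℤ × ℤ) : Prop where
  colour : (∀ p, (IsWhite (σ p) ↔ IsWhite p) ∧ (IsBlack (σ p) ↔ IsBlack p)) ∨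
    ∀ p, (IsWhite (σ p) ↔ IsBlack p) ∧ (IsBlack (σ p) ↔ IsWhite p)
  dist : ∃ C, ∀ p, |gridDist 0 (σ p) - gridDist 0 p| ≤ C
  torus : ∀ n, ∃ τ : ZMod (2 * n) × ZMod (2 * n) ≃ ZMod (2 * n) × ZMod (2 * n),
    (∀ u v, (cornerGraph n n).Adj (τ u) (τ v) ↔ (cornerGraph n n).Adj u v) ∧
      ∀ p, τ (toTorus n n p) = toTorus n n (σ p)

namespace IsGridSymmetry

variable {σ : ℤ × ℤ ≃ ℤ × ℤ}

theorem symm (h : IsGridSymmetry σ) : IsGridSymmetry σ.symm where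
  colour := by
    rcases h.colour with h | h
    · exact Or.inl fun p => by simpa [iff_comm] using h (σ.symm p)
    · refine Or.inr fun p => ?_
      have := h (σ.symm p)
      rw [σ.apply_symm_apply] at this
      exact ⟨this.2.symm, this.1.symm⟩
  dist := by
    obtain ⟨C, hC⟩ := h.dist
    refine ⟨C, fun p => ?_⟩
    rw [abs_sub_comm]
    simpa using hC (σ.symm p)
  torus n := by
    obtain ⟨τ, h1, h2⟩ := h.torus n
    refine ⟨τ.symm, fun u v => ?_, fun p => ?_⟩
    · rw [← h1, τ.apply_symm_apply, τ.apply_symm_apply]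
    · rw [Equiv.symm_apply_eq, h2, σ.apply_symm_apply]

theorem isVertex_iff (h : IsGridSymmetry σ) (p : ℤ × ℤ) : IsVertex (σ p) ↔ IsVertex p := by
  have hv : ∀ q, IsVertex q ↔ IsWhite q ∨ IsBlack q := fun q => by
    have := Int.even_or_odd q.1
    simp only [IsWhite, IsBlack]
    tauto
  rw [hv, hv]
  rcases h.colour with h | h <;> have := h p <;> tauto

end IsGridSymmetry

theorem isPerfectMatching_map_iso {V W : Type*} {G : SimpleGraph V} {H : SimpleGraph W}
    (e : G ≃g H) {M : G.Subgraph} (hM : M.IsPerfectMatching) :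
    (M.map e.toHom).IsPerfectMatching :=
  ⟨hM.1.map _ e.injective, fun w => ⟨e.symm w, hM.2 _, e.apply_symm_apply w⟩⟩

theorem numMatchings_iso {V W : Type*} {G : SimpleGraph V} {H : SimpleGraph W} (e : G ≃g H) :
    numMatchings G = numMatchings H := by
  refine Nat.card_congr
    { toFun := fun M => ⟨M.1.map e.toHom, isPerfectMatching_map_iso e M.2⟩
      invFun := fun M => ⟨M.1.map e.symm.toHom, isPerfectMatching_map_iso e.symm M.2⟩
      left_inv := fun M => Subtype.ext ?_
      right_inv := fun M => Subtype.ext ?_ }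
  · dsimp only
    rw [← SimpleGraph.Subgraph.map_comp]
    convert SimpleGraph.Subgraph.map_id M.1
    ext; simp
  · dsimp only
    rw [← SimpleGraph.Subgraph.map_comp]
    convert SimpleGraph.Subgraph.map_id M.1
    ext; simp

namespace IsGridSymmetry

variable {σ : ℤ × ℤ ≃ ℤ × ℤ}

theorem numMatchings_image (h : IsGridSymmetry σ) (n : ℕ) (S : Finset (ℤ × ℤ)) :
    numMatchings (torusMinus n n (S.image σ)) = numMatchings (torusMinus n n S) := by
  obtain ⟨τ, h1, h2⟩ := h.torus n
  have hV : ∀ u, u ∈ torusVertices n n ↔ τ u ∈ torusVertices n n := by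
    intro u
    constructor
    · rintro ⟨p, hp, rfl⟩
      exact ⟨σ p, (h.isVertex_iff p).2 hp, (h2 p).symm⟩
    · rintro ⟨p, hp, hu⟩
      refine ⟨σ.symm p, (h.symm.isVertex_iff p).2 hp, τ.injective ?_⟩
      rw [h2, σ.apply_symm_apply, hu]
  have hS : ∀ u, u ∈ toTorus n n '' (S : Set (ℤ × ℤ)) ↔
      τ u ∈ toTorus n n '' ((S.image σ : Finset (ℤ × ℤ)) : Set (ℤ × ℤ)) := by
    intro u
    simp only [Set.mem_image, SetLike.mem_coe, Finset.mem_image, exists_exists_and_eq_and, ← h2,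
      τ.injective.eq_iff]
  refine (numMatchings_iso (G := torusMinus n n S)
    ⟨τ.subtypeEquiv fun u => ?_, fun {u v} => h1 u v⟩).symm
  rw [Set.mem_sdiff, Set.mem_sdiff, ← hV, ← hS]

theorem charge_image (h : IsGridSymmetry σ) (S : Finset (ℤ × ℤ)) :
    ((∀ p, (IsWhite (σ p) ↔ IsWhite p) ∧ (IsBlack (σ p) ↔ IsBlack p)) ∧
      charge (S.image σ) = charge S) ∨
    (∀ p, (IsWhite (σ p) ↔ IsBlack p) ∧ (IsBlack (σ p) ↔ IsWhite p)) ∧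
      charge (S.image σ) = -charge S := by
  simp only [charge, Finset.filter_image, Finset.card_image_of_injective _ σ.injective]
  rcases h.colour with h | h
  · exact Or.inl ⟨h, by simp only [(h _).1, (h _).2]⟩
  · exact Or.inr ⟨h, by simp only [(h _).1, (h _).2]; ring⟩

/-- The recursive definition measures distance from the origin, which does not move with the holes;
a bounded discrepancy is negligible far away. -/
theorem tendsto_ratio (h : IsGridSymmetry σ) :
    Tendsto (fun x => gridDist 0 (σ x) / gridDist 0 x) cofinite (𝓝 1) := by
  obtain ⟨C, hC⟩ := h.dist
  have h1 : Tendsto (fun x => (gridDist 0 (σ x) - gridDist 0 x) / gridDist 0 x) cofinite (𝓝 0) := by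
    refine squeeze_zero_norm (fun x => ?_) (tendsto_gridDist_cofinite.const_div_atTop C)
    have : 0 ≤ gridDist 0 x := Real.sqrt_nonneg _
    rw [norm_div, Real.norm_eq_abs, Real.norm_of_nonneg this]
    exact div_le_div_of_nonneg_right (hC x) this
  have h2 := h1.add_const 1
  rw [zero_add] at h2
  refine h2.congr' ?_
  filter_upwards [tendsto_gridDist_cofinite.eventually_gt_atTop 0] with x hx
  field_simp
  ring

theorem tendsto_farAway (σ : ℤ × ℤ ≃ ℤ × ℤ) {P Q : ℤ × ℤ → Prop} (h : ∀ x, P x → Q (σ x)) :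
    Tendsto σ (farAway P) (farAway Q) :=
  Tendsto.inf σ.injective.tendsto_cofinite (tendsto_principal_principal.2 h)

/-- Induction on the charge, carrying the auxiliary monomer along with `σ`. The normalization `μ` is
the same for both colours, so colour-swapping symmetries are allowed. -/
theorem hasCorrelationOfCharge_image (h : IsGridSymmetry σ) {q : ℕ} {S : Finset (ℤ × ℤ)} {a : ℝ}
    (hq : (charge S).natAbs = q) (ha : HasCorrelationOfCharge q S a) :
    HasCorrelationOfCharge q (S.image σ) a := by
  induction q generalizing S a with
  | zero =>
    refine Tendsto.congr (fun n => ?_) ha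
    rw [finiteCorrelation, finiteCorrelation, h.numMatchings_image]
  | succ q ih =>
    obtain ⟨μ, hμ, f, hf, ht⟩ := ha
    have hback : Tendsto σ.symm
        (farAway (if 0 < charge (S.image σ) then IsBlack else IsWhite))
        (farAway (if 0 < charge S then IsBlack else IsWhite)) := by
      refine tendsto_farAway σ.symm fun x hx => ?_
      rcases h.charge_image S with ⟨hcol, hch⟩ | ⟨hcol, hch⟩ <;> rw [hch] at hx <;>
        have := hcol (σ.symm x) <;> rw [σ.apply_symm_apply] at this
      · split_ifs at hx ⊢
        · exact this.2.1 hx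
        · exact this.1.1 hx
      · split_ifs at hx ⊢
        · omega
        · exact this.1.1 hx
        · exact this.2.1 hx
        -- Charge 0, where the default colour would not be swapped along with `σ`, is excluded by
        -- `hq`.
        · omega
    refine ⟨μ, hμ, fun y => f (σ.symm y), ?_, ?_⟩
    · have hins : ∀ᶠ x in farAway (if 0 < charge S then IsBlack else IsWhite),
          HasCorrelationOfCharge q ((insert x S).image σ) (f x) := by
        have hcol : ∀ᶠ x in farAway (if 0 < charge S then IsBlack else IsWhite),
            (if 0 < charge S then IsBlack else IsWhite) x := mem_inf_of_right (mem_principal_self _)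
        have hout : ∀ᶠ x in farAway (if 0 < charge S then IsBlack else IsWhite), x ∉ S :=
          mem_inf_of_left S.finite_toSet.compl_mem_cofinite
        filter_upwards [hf, hcol, hout] with x hx hxc hxS
        refine ih ?_ hx
        split_ifs at hxc
        · rw [charge_insert_black hxc hxS]; omega
        · rw [charge_insert_white hxc hxS]; omega
      filter_upwards [hback.eventually hins] with y hy
      rwa [Finset.image_insert, σ.apply_symm_apply] at hy
    · have hr : Tendsto (fun x => (gridDist 0 (σ x) / gridDist 0 x) ^ (((q + 1 : ℕ) : ℝ) / 2))
          (farAway (if 0 < charge S then IsBlack else IsWhite)) (𝓝 1) := by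
        have := h.tendsto_ratio.rpow_const (p := ((q + 1 : ℕ) : ℝ) / 2) (Or.inl one_ne_zero)
        rw [Real.one_rpow] at this
        exact this.mono_left inf_le_left
      have hm := hr.mul ht
      rw [one_mul] at hm
      have hm' : Tendsto (fun x => gridDist 0 (σ x) ^ (((q + 1 : ℕ) : ℝ) / 2) * f x / μ)
          (farAway (if 0 < charge S then IsBlack else IsWhite)) (𝓝 a) := by
        refine hm.congr' ?_
        filter_upwards [(tendsto_gridDist_cofinite.mono_left inf_le_left).eventually_gt_atTop 0]
          with x hx
        have : 0 ≤ gridDist 0 (σ x) := Real.sqrt_nonneg _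
        have := Real.rpow_pos_of_pos hx (((q + 1 : ℕ) : ℝ) / 2)
        rw [Real.div_rpow (by assumption) hx.le]
        field_simp
      refine (hm'.comp hback).congr fun y => ?_
      simp only [Function.comp_apply, σ.apply_symm_apply]

theorem hasCorrelation_image_iff (h : IsGridSymmetry σ) {S : Finset (ℤ × ℤ)} {a : ℝ} :
    HasCorrelation (S.image σ) a ↔ HasCorrelation S a := by
  have hc : (charge (S.image σ)).natAbs = (charge S).natAbs := by
    rcases h.charge_image S with ⟨-, hch⟩ | ⟨-, hch⟩ <;> rw [hch]
    exact Int.natAbs_neg _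
  constructor
  · intro H
    have := h.symm.hasCorrelationOfCharge_image rfl H
    rw [hc, Finset.image_image, σ.symm_comp_self, Finset.image_id] at this
    exact this
  · intro H
    unfold HasCorrelation
    rw [hc]
    exact h.hasCorrelationOfCharge_image rfl H

/-- The two predicates are equal, so the chosen values agree without appeal to uniqueness of limits.
-/
theorem correlation_image (h : IsGridSymmetry σ) (S : Finset (ℤ × ℤ)) :
    correlation (S.image σ) = correlation S := by
  have : HasCorrelation (S.image σ) = HasCorrelation S :=
    funext fun a => propext h.hasCorrelation_image_iff
  unfold correlation
  rw [this]

end IsGridSymmetry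

/-! ### Translations and transposition -/

theorem isGridSymmetry_addRight {v : ℤ × ℤ} (hv : Even (v.1 + v.2)) :
    IsGridSymmetry (Equiv.addRight v) where
  colour := by
    simp only [IsWhite, IsBlack, IsVertex, Equiv.coe_addRight, Prod.fst_add, Prod.snd_add,
      Int.even_iff, Int.odd_iff] at hv ⊢
    rcases Int.emod_two_eq_zero_or_one v.1 with h | h
    · exact Or.inl fun p => by omega
    · exact Or.inr fun p => by omega
  dist := by
    refine ⟨‖toComplex v‖ / √2, fun p => ?_⟩
    have e : toComplex (p + v) = toComplex p + toComplex v := by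
      simp [toComplex]; ring
    have e0 : toComplex 0 = 0 := by simp [toComplex]
    rw [Equiv.coe_addRight, gridDist_eq_norm, gridDist_eq_norm, ← sub_div, abs_div,
      abs_of_nonneg (Real.sqrt_nonneg 2), e, e0, zero_sub, zero_sub, norm_neg, norm_neg]
    gcongr
    have := abs_norm_sub_norm_le (toComplex p + toComplex v) (toComplex p)
    rwa [add_sub_cancel_left] at this
  torus n := by
    refine ⟨Equiv.addRight (toTorus n n v), fun u w => ?_, fun p => ?_⟩
    · simp only [cornerGraph, Equiv.coe_addRight, Prod.fst_add, Prod.snd_add, ne_eq,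
        add_left_inj, add_right_comm _ _ (1 : ZMod (2 * n))]
    · simp [toTorus]

theorem isGridSymmetry_prodComm : IsGridSymmetry (Equiv.prodComm ℤ ℤ) where
  colour := by
    simp only [IsWhite, IsBlack, IsVertex, Equiv.coe_prodComm, Prod.fst_swap, Prod.snd_swap,
      Int.even_iff, Int.odd_iff]
    exact Or.inr fun p => by omega
  dist := by
    refine ⟨0, fun p => ?_⟩
    have := gridDist_swap 0 p
    rw [Equiv.coe_prodComm, ← this, Prod.swap_zero, sub_self, abs_zero]
  torus n := by
    refine ⟨Equiv.prodComm _ _, fun u w => ?_, fun p => rfl⟩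
    simp only [cornerGraph, Equiv.coe_prodComm, ne_eq, Prod.swap_inj, Prod.fst_swap,
      Prod.snd_swap]
    tauto

theorem mem_image_equiv (σ : ℤ × ℤ ≃ ℤ × ℤ) {S : Finset (ℤ × ℤ)} {p : ℤ × ℤ} :
    p ∈ S.image σ ↔ σ.symm p ∈ S := by
  rw [Finset.mem_image]
  exact ⟨by rintro ⟨q, hq, rfl⟩; simpa using hq, fun h => ⟨_, h, σ.apply_symm_apply p⟩⟩

/-- Translations by two odd coordinates swap the colours, so white-placed and black-placed holes are
both covered. -/
theorem correlation_oddAztecRect_eq {k l : ℕ} {c c' : ℤ × ℤ} (hc : IsCentre k l c)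
    (hc' : IsCentre k l c') :
    correlation (oddAztecRect k l c) = correlation (oddAztecRect k l c') := by
  rw [isCentre_iff] at hc hc'
  have h : oddAztecRect k l c' = (oddAztecRect k l c).image (Equiv.addRight (c' - c)) := by
    ext p
    rw [mem_image_equiv, mem_oddAztecRect, mem_oddAztecRect]
    simp
    omega
  rw [h, IsGridSymmetry.correlation_image (isGridSymmetry_addRight ?_)]
  rw [Int.even_iff, Prod.fst_sub, Prod.snd_sub]
  omega

theorem correlation_oddAztecRect_swap {k l : ℕ} {c c' : ℤ × ℤ} (hc : IsCentre k l c)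
    (hc' : IsCentre l k c') :
    correlation (oddAztecRect k l c) = correlation (oddAztecRect l k c') := by
  have h : oddAztecRect l k c.swap = (oddAztecRect k l c).image (Equiv.prodComm ℤ ℤ) := by
    ext p
    rw [mem_image_equiv, mem_oddAztecRect, mem_oddAztecRect]
    simp
    omega
  rw [← isGridSymmetry_prodComm.correlation_image, ← h]
  refine correlation_oddAztecRect_eq ?_ hc'
  rw [isCentre_iff] at hc ⊢
  dsimp only [Prod.fst_swap, Prod.snd_swap]
  omega

/-! ### Pairs of holes of opposite charges -/

theorem holes_pair (k l k' l' : ℕ) (c c' : ℤ × ℤ) :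
    holes ![k, k'] ![l, l'] ![c, c'] = oddAztecRect k l c ∪ oddAztecRect k' l' c' := by
  ext p
  simp [holes, Fin.exists_fin_two]

theorem tendsto_largeSeparation_pair {k l k' l' : ℕ} {c : ℤ × ℤ} {c' : ℕ → ℤ × ℤ}
    (hc : IsCentre k l c) (hc' : ∀ t, IsCentre k' l' (c' t))
    (hd : Tendsto (fun t => gridDist c (c' t)) atTop atTop) :
    Tendsto (fun t => ![c, c' t]) atTop (largeSeparation ![k, k'] ![l, l']) := by
  refine tendsto_inf.2 ⟨?_, tendsto_principal.2 (Eventually.of_forall fun t => ?_)⟩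
  · simp only [tendsto_iInf, tendsto_comap_iff]
    intro i j hij
    obtain rfl : i = 0 := by rw [Fin.ext_iff, Fin.val_zero]; omega
    obtain rfl : j = 1 := by rw [Fin.ext_iff, Fin.val_one]; omega
    exact hd
  · exact Fin.forall_fin_two.2 ⟨hc, hc' t⟩

/-- The asymptotics of the correlation of two holes of opposite charges. -/
theorem ElectrostaticConjecture.tendsto_pair (hEC : ElectrostaticConjecture) {k l k' l' : ℕ}
    {c : ℤ × ℤ} {c' : ℕ → ℤ × ℤ} (hc : IsCentre k l c) (hc' : ∀ t, IsCentre k' l' (c' t))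
    (hd : Tendsto (fun t => gridDist c (c' t)) atTop atTop)
    (hdisj : ∀ t, Disjoint (oddAztecRect k l c) (oddAztecRect k' l' (c' t))) {Q A : ℝ}
    (hneutral : ∀ t, charge (oddAztecRect k l c) + charge (oddAztecRect k' l' (c' t)) = 0)
    (hQ : (charge (oddAztecRect k l c) : ℝ) ^ 2 = Q)
    (hA : ∀ t, correlation (oddAztecRect k' l' (c' t)) = A) :
    ∃ W : ℕ → ℝ,
      (∀ᶠ t in atTop,
        HasNeutralCorrelation (oddAztecRect k l c ∪ oddAztecRect k' l' (c' t)) (W t)) ∧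
      Tendsto (fun t => W t / gridDist c (c' t) ^ (-(1 / 2 * Q))) atTop
        (𝓝 (correlation (oddAztecRect k l c) * A)) := by
  obtain ⟨hex, hequiv⟩ := hEC.2 2 ![k, k'] ![l, l']
  have ht := tendsto_largeSeparation_pair hc hc' hd
  have hex := ht.eventually hex
  have hequiv := hequiv.comp_tendsto ht
  have hpairs : (Finset.univ.filter fun p : Fin 2 × Fin 2 => p.1 < p.2) = {(0, 1)} := by decide
  have hexp : ∀ t, 1 / 2 * (charge (oddAztecRect k l c) : ℝ) *
      (charge (oddAztecRect k' l' (c' t)) : ℝ) = -(1 / 2 * Q) := fun t => by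
    rw [← hQ, eq_neg_of_add_eq_zero_right (hneutral t)]
    push_cast
    ring
  have hfun : ((fun c => (∏ i, correlation (oddAztecRect (![k, k'] i) (![l, l'] i) (c i))) *
        ∏ p : Fin 2 × Fin 2 with p.1 < p.2, gridDist (c p.1) (c p.2) ^
          ((1 / 2 : ℝ) * (charge (oddAztecRect (![k, k'] p.1) (![l, l'] p.1) (c p.1)) : ℝ) *
            (charge (oddAztecRect (![k, k'] p.2) (![l, l'] p.2) (c p.2)) : ℝ))) ∘
        fun t => ![c, c' t]) = fun t =>
      correlation (oddAztecRect k l c) * A * gridDist c (c' t) ^ (-(1 / 2 * Q)) := by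
    funext t
    rw [Function.comp_apply, hpairs, Finset.prod_singleton, Fin.prod_univ_two]
    simp only [Matrix.cons_val_zero, Matrix.cons_val_one, hexp, hA]
  rw [hfun] at hequiv
  refine ⟨fun t => correlation (holes ![k, k'] ![l, l'] ![c, c' t]), ?_, ?_⟩
  · filter_upwards [hex] with t h
    have h := correlation_spec h
    -- At total charge 0 the recursion is empty and the correlation is the plain limit of matching
    -- ratios.
    rw [HasCorrelation, holes_pair, charge_union (hdisj t), hneutral t] at h
    rw [holes_pair]
    exact h
  · have h := hequiv.div (IsEquivalent.refl (u := fun t => gridDist c (c' t) ^ (-(1 / 2 * Q))))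
    refine h.symm.tendsto_nhds (tendsto_const_nhds.congr' ?_)
    filter_upwards [hd.eventually_gt_atTop 0] with t hpos
    have := (Real.rpow_pos_of_pos hpos (-(1 / 2 * Q))).ne'
    rw [Pi.div_apply, mul_div_cancel_right₀ _ this]

/-! ### Change of shape at fixed absolute charge -/

theorem HasNeutralCorrelation.mul_eq_mul {S S' : Finset (ℤ × ℤ)} {a a' x x' : ℝ}
    (h : HasNeutralCorrelation S a) (h' : HasNeutralCorrelation S' a')
    (hM : ∀ᶠ n : ℕ in atTop, (numMatchings (torusMinus n n S) : ℝ) * x =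
      (numMatchings (torusMinus n n S') : ℝ) * x') : a * x = a' * x' := by
  refine tendsto_nhds_unique (Tendsto.mul_const x h) ((Tendsto.mul_const x' h').congr' ?_)
  filter_upwards [hM] with n hn
  rw [finiteCorrelation, finiteCorrelation, div_mul_eq_mul_div, div_mul_eq_mul_div, hn]

/-- The correlations of the holes of shapes `O_{k,l+1}` and `O_{k+1,l}`. -/
theorem ElectrostaticConjecture.correlation_sq_mul (hEC : ElectrostaticConjecture) {k l : ℕ}
    {c c' : ℤ × ℤ} (hc : IsCentre k (l + 1) c) (hc' : IsCentre (k + 1) l c') :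
    correlation (oddAztecRect k (l + 1) c) ^ 2 * 2 ^ k =
      correlation (oddAztecRect (k + 1) l c') ^ 2 * 2 ^ l := by
  -- At `p` the shape `O_{k,l+1}` is white-placed; at `s t`, whose row has the parity of `l`, the
  -- shape `O_{l+1,k}` is black-placed. The shift in `s` keeps the holes disjoint for every `t`.
  set p : ℤ × ℤ := (k, l) with hp
  set s : ℕ → ℤ × ℤ := fun t => (l + 2 * (t + k + l + 3 : ℕ) + 2 * k, k) with hs
  have h1 : IsCentre k (l + 1) p := by rw [isCentre_iff]; simp [hp]
  have h2 : ∀ t, IsCentre (l + 1) k (s t) := fun t => by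
    rw [isCentre_iff]; simp only [hs]; push_cast; omega
  have h3 : IsCentre (k + 1) l p := by rw [isCentre_iff]; simp [hp]
  have h4 : ∀ t, IsCentre l (k + 1) (s t) := fun t => by
    rw [isCentre_iff]; simp only [hs]; push_cast; omega
  have hd : Tendsto (fun t => gridDist p (s t)) atTop atTop := by
    refine tendsto_atTop_mono (fun t => ?_) (tendsto_natCast_atTop_atTop (R := ℝ))
    have h := (abs_le.1 (abs_row_sub_le p (s t))).1
    simp only [hs] at h ⊢
    simp only [hp] at h ⊢
    push_cast at h ⊢
    have : (0 : ℝ) ≤ k := k.cast_nonneg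
    have : (0 : ℝ) ≤ l := l.cast_nonneg
    linarith
  have hq1 : charge (oddAztecRect k (l + 1) p) = k + l + 2 := by
    rw [charge_oddAztecRect h1, if_pos (by simp [hp])]; push_cast; ring
  have hq2 : ∀ t, charge (oddAztecRect (l + 1) k (s t)) = -(k + l + 2) := fun t => by
    rw [charge_oddAztecRect (h2 t), if_neg (by simp only [hs]; push_cast; omega)]; push_cast; ring
  have hq3 : charge (oddAztecRect (k + 1) l p) = -(k + l + 2) := by
    rw [charge_oddAztecRect h3, if_neg (by simp only [hp]; push_cast; omega)]; push_cast; ring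
  have hq4 : ∀ t, charge (oddAztecRect l (k + 1) (s t)) = k + l + 2 := fun t => by
    rw [charge_oddAztecRect (h4 t), if_pos (by simp only [hs]; omega)]; push_cast; ring
  -- The partner is the transposed shape, so the limiting constant is a square.
  obtain ⟨W, hW, hWt⟩ := hEC.tendsto_pair h1 h2 hd
    (fun t => disjoint_oddAztecRect (by simp only [hp, hs]; push_cast; omega))
    (fun t => by rw [hq1, hq2]; ring) rfl
    (fun t => (correlation_oddAztecRect_swap h1 (h2 t)).symm)
  obtain ⟨W', hW', hWt'⟩ := hEC.tendsto_pair h3 h4 hd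
    (fun t => disjoint_oddAztecRect (by simp only [hp, hs]; push_cast; omega))
    (fun t => by rw [hq3, hq4]; ring) (by rw [hq3, Int.cast_neg, neg_sq, ← hq1])
    (fun t => (correlation_oddAztecRect_swap h3 (h4 t)).symm)
  rw [correlation_oddAztecRect_eq hc h1, correlation_oddAztecRect_eq hc' h3, sq, sq]
  -- Both pairs have the same centres and the same squared charge, so both limits are normalized by
  -- the same power of the distance.
  refine tendsto_nhds_unique (hWt.mul_const (2 ^ k)) ((hWt'.mul_const (2 ^ l)).congr' ?_)
  filter_upwards [hW, hW'] with t ht ht'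
  rw [div_mul_eq_mul_div (W t), div_mul_eq_mul_div (W' t), ht.mul_eq_mul ht'
    (numMatchings_two_holes h1 (by simp [hp]) (h2 t) (by simp only [hs]; omega)
      (by simp only [hp, hs]; push_cast; omega))]

/-- One exchange contributes `2^(l-k)`, and `(k+1)l - k(l+1) = l - k`, so the exponents telescope to
`kl`. -/
theorem ElectrostaticConjecture.correlation_sq (hEC : ElectrostaticConjecture) {k l : ℕ}
    {c c' : ℤ × ℤ} (hc : IsCentre k l c) (hc' : IsCentre 0 (k + l) c') :
    correlation (oddAztecRect k l c) ^ 2 * 2 ^ (k * l) =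
      correlation (oddAztecRect 0 (k + l) c') ^ 2 := by
  induction k generalizing l c with
  | zero =>
    rw [zero_add] at hc'
    rw [zero_mul, pow_zero, mul_one, zero_add, correlation_oddAztecRect_eq hc hc']
  | succ k ih =>
    have hd : IsCentre k (l + 1) c := by
      rw [isCentre_iff] at hc ⊢
      push_cast at hc ⊢
      omega
    have he : k + 1 + l = k + (l + 1) := by ring
    rw [he] at hc' ⊢
    rw [← ih hd hc', show (k + 1) * l = l + k * l by ring, show k * (l + 1) = k + k * l by ring,
      pow_add, pow_add, ← mul_assoc, ← mul_assoc, hEC.correlation_sq_mul hd hc]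

end AztecWindows

theorem theorem4p6 (hEC : AztecWindows.ElectrostaticConjecture) (k l : ℕ) (c c' : ℤ × ℤ)
    (hc : AztecWindows.IsCentre k l c) (hc' : AztecWindows.IsCentre 0 (k + l) c') :
    AztecWindows.HasCorrelation (AztecWindows.oddAztecRect k l c)
        (AztecWindows.correlation (AztecWindows.oddAztecRect k l c)) ∧
      AztecWindows.HasCorrelation (AztecWindows.oddAztecRect 0 (k + l) c')
        (AztecWindows.correlation (AztecWindows.oddAztecRect 0 (k + l) c')) ∧
      AztecWindows.correlation (AztecWindows.oddAztecRect k l c) =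
        (2 : ℝ) ^ (-((k : ℝ) * (l : ℝ)) / 2) *
          AztecWindows.correlation (AztecWindows.oddAztecRect 0 (k + l) c') := by
  refine ⟨AztecWindows.correlation_spec (hEC.1 _ _ _ hc),
    AztecWindows.correlation_spec (hEC.1 _ _ _ hc'), ?_⟩
  have h2 : (0 : ℝ) < 2 ^ (-((k : ℝ) * (l : ℝ)) / 2) := by positivity
  have h0 := AztecWindows.correlation_nonneg (AztecWindows.oddAztecRect 0 (k + l) c')
  -- Only the squares are known to agree; both sides are nonnegative.
  refine (pow_left_inj₀ (AztecWindows.correlation_nonneg _) (mul_nonneg h2.le h0)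
    two_ne_zero).1 ?_
  have hp : ((2 : ℝ) ^ (-((k : ℝ) * (l : ℝ)) / 2)) ^ 2 * 2 ^ (k * l) = 1 := by
    rw [← Real.rpow_mul_natCast zero_le_two, ← Real.rpow_natCast 2 (k * l),
      ← Real.rpow_add two_pos, Nat.cast_mul, Nat.cast_ofNat, div_mul_cancel₀ _ two_ne_zero,
      neg_add_cancel, Real.rpow_zero]
  rw [mul_pow, ← hEC.correlation_sq hc hc', mul_left_comm, hp, mul_one]
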